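/- Let $k$ be an algebraically closed field of characteristic different from $2$. A conic cone with cone point $p \in \mathbb{P}^3_k$ is the pullback of a smooth conic in $\mathbb{P}^2_k$ along a linear projection $\mathbb{P}^3_k \dashrightarrow \mathbb{P}^2_k$ with center $p$. Let $X_1$ and $X_2$ be two conic cones in $\mathbb{P}^3_k$ with distinct cone points. Then the scheme-theoretic intersection $X_1 \cap X_2$ is one of the following (all unions being scheme-theoretic): 1. an integral (that is, irreducible and reduced) curve of degree $4$; 2. a union of a twisted cubic and a line; 3. a union of two distinct smooth conics; 4. a union of one smooth conic and a doubled line, where a doubled line is a subscheme $\{\ell = m^2 = 0\}$ with $\ell, m$ linearly independent linear forms (the square of a line in a plane). Moreover, $X_1 \cap X_2$ is never a doubled conic (a closed subscheme of degree $4$ whose reduction is a smooth conic), never a quadrupled line (a closed subscheme of degree $4$ whose reduction is a line), and never contains two distinct lines. -/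

import Mathlib

open MvPolynomial Filter
open scoped LinearAlgebra.Projectivization

namespace ConicCones

attribute [local instance] MvPolynomial.gradedAlgebra

/-- The homogeneous coordinate ring `k[x₀, x₁, x₂, x₃]` of `ℙ³` over `k`. -/
abbrev CoordRing (k : Type*) [Field k] : Type _ := MvPolynomial (Fin 4) k

/-- The irrelevant ideal `(x₀, x₁, x₂, x₃)`. -/
noncomputable def irrelevantIdeal (k : Type*) [Field k] : Ideal (CoordRing k) :=
  Ideal.span (Set.range (X : Fin 4 → CoordRing k))

/-- The saturation of an ideal `I` with respect to the irrelevant ideal `𝔪`: all `f` with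
`𝔪 ^ n * f ⊆ I` for some `n`. -/
noncomputable def saturation {k : Type*} [Field k] (I : Ideal (CoordRing k)) : Ideal (CoordRing k) where
  carrier := {f | ∃ n : ℕ, ∀ g ∈ irrelevantIdeal k ^ n, g * f ∈ I}
  zero_mem' := ⟨0, fun g _ => by simp⟩
  add_mem' := by
    rintro a b ⟨m, hm⟩ ⟨n, hn⟩
    refine ⟨max m n, fun g hg => ?_⟩
    rw [mul_add]
    exact I.add_mem (hm g (Ideal.pow_le_pow_right (le_max_left m n) hg))
      (hn g (Ideal.pow_le_pow_right (le_max_right m n) hg))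
  smul_mem' := by
    rintro c f ⟨n, hn⟩
    refine ⟨n, fun g hg => ?_⟩
    rw [smul_eq_mul, mul_left_comm]
    exact I.mul_mem_left c (hn g hg)

/-- A closed subscheme of `ℙ³` over `k`, given by its saturated homogeneous ideal
(closed subschemes correspond bijectively to such ideals). -/
@[ext]
structure ClosedSubscheme (k : Type*) [Field k] where
  /-- The ideal of all polynomials that vanish on the subscheme. -/
  ideal : Ideal (CoordRing k)
  homogeneous : ideal.IsHomogeneous (homogeneousSubmodule (Fin 4) k)
  saturated : saturation ideal = ideal

theorem le_saturation {k : Type*} [Field k] (I : Ideal (CoordRing k)) : I ≤ saturation I :=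
  fun _ hf => ⟨0, fun g _ => I.mul_mem_left g hf⟩

theorem saturation_mono {k : Type*} [Field k] {I J : Ideal (CoordRing k)} (h : I ≤ J) :
    saturation I ≤ saturation J := by
  rintro f ⟨n, hn⟩
  exact ⟨n, fun g hg => h (hn g hg)⟩

theorem saturation_saturation {k : Type*} [Field k] (I : Ideal (CoordRing k)) :
    saturation (saturation I) = saturation I := by
  refine le_antisymm ?_ (le_saturation _)
  rintro f ⟨n, hn⟩
  obtain ⟨s, hs⟩ := IsNoetherian.noetherian (irrelevantIdeal k ^ n)
  have key : ∀ t : Finset (CoordRing k), (∀ b ∈ t, b ∈ irrelevantIdeal k ^ n) →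
      ∃ N : ℕ, ∀ b ∈ t, ∀ a ∈ irrelevantIdeal k ^ N, a * (b * f) ∈ I := by
    classical
    intro t
    induction t using Finset.induction_on with
    | empty => intro _; exact ⟨0, by simp⟩
    | insert b t _ ih =>
      intro ht
      obtain ⟨N, hN⟩ := ih fun x hx => ht x (Finset.mem_insert_of_mem hx)
      obtain ⟨M, hM⟩ := hn b (ht b (Finset.mem_insert_self b t))
      refine ⟨max M N, fun x hx a ha => ?_⟩
      rcases Finset.mem_insert.1 hx with rfl | hx
      · exact hM a (Ideal.pow_le_pow_right (le_max_left M N) ha)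
      · exact hN x hx a (Ideal.pow_le_pow_right (le_max_right M N) ha)
  obtain ⟨N, hN⟩ := key s (fun b hb => by rw [← hs]; exact Submodule.subset_span hb)
  refine ⟨N + n, fun g hg => ?_⟩
  rw [pow_add] at hg
  refine Submodule.mul_induction_on hg (fun a ha b hb => ?_) (fun x y hx hy => ?_)
  · rw [← hs] at hb
    refine Submodule.span_induction (fun x hx => ?_) (by simp) (fun x y _ _ hx hy => ?_)
      (fun c x _ hx => ?_) hb
    · rw [mul_assoc]
      exact hN x hx a ha
    · rw [mul_add, add_mul]
      exact I.add_mem hx hy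
    · rw [smul_eq_mul, mul_left_comm, mul_assoc]
      exact I.mul_mem_left c hx
  · rw [add_mul]
    exact I.add_mem hx hy

theorem irrelevantIdeal_pow_isHomogeneous (k : Type*) [Field k] (n : ℕ) :
    (irrelevantIdeal k ^ n).IsHomogeneous (homogeneousSubmodule (Fin 4) k) := by
  have h1 : (irrelevantIdeal k).IsHomogeneous (homogeneousSubmodule (Fin 4) k) := by
    refine Ideal.homogeneous_span _ _ ?_
    rintro _ ⟨i, rfl⟩
    exact ⟨1, isHomogeneous_X k i⟩
  induction n with
  | zero => rw [pow_zero, Ideal.one_eq_top]; exact Ideal.IsHomogeneous.top _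
  | succ n ih => rw [pow_succ]; exact ih.mul h1

theorem saturation_isHomogeneous {k : Type*} [Field k] {I : Ideal (CoordRing k)}
    (hI : I.IsHomogeneous (homogeneousSubmodule (Fin 4) k)) :
    (saturation I).IsHomogeneous (homogeneousSubmodule (Fin 4) k) := by
  classical
  rintro i f ⟨n, hn⟩
  refine ⟨n, fun g hg => ?_⟩
  rw [← DirectSum.sum_support_decompose (homogeneousSubmodule (Fin 4) k) g, Finset.sum_mul]
  refine I.sum_mem fun j _ => ?_
  rw [← DirectSum.coe_decompose_mul_add_of_left_mem (homogeneousSubmodule (Fin 4) k)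
    (SetLike.coe_mem _)]
  exact hI _ (hn _ (irrelevantIdeal_pow_isHomogeneous k n j hg))

variable {k : Type*} [Field k]

namespace ClosedSubscheme

/-- The scheme-theoretic intersection: the ideal is the saturation of the sum of the ideals. -/
noncomputable def inter (Y Z : ClosedSubscheme k) : ClosedSubscheme k where
  ideal := saturation (Y.ideal ⊔ Z.ideal)
  homogeneous := saturation_isHomogeneous (Y.homogeneous.sup Z.homogeneous)
  saturated := saturation_saturation _

/-- The scheme-theoretic union: the ideal is the intersection of the ideals. -/
noncomputable def union (Y Z : ClosedSubscheme k) : ClosedSubscheme k where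
  ideal := Y.ideal ⊓ Z.ideal
  homogeneous := Y.homogeneous.inf Z.homogeneous
  saturated := le_antisymm
    (le_inf ((saturation_mono inf_le_left).trans Y.saturated.le)
      ((saturation_mono inf_le_right).trans Z.saturated.le))
    (le_saturation _)

/-- `Z.Contains Y`: `Y` is a closed subscheme of `Z`. -/
def Contains (Z Y : ClosedSubscheme k) : Prop := Z.ideal ≤ Y.ideal

/-- `Z` is the closed subscheme defined by the vanishing of the homogeneous forms in `S`. -/
def IsCutOutBy (Z : ClosedSubscheme k) (S : Set (CoordRing k)) : Prop :=
  Z.ideal = saturation (Ideal.span S)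

/-- The Hilbert function of `Z`: the dimension of the degree `n` part of the homogeneous
coordinate ring of `Z`. -/
noncomputable def hilbertFunction (Z : ClosedSubscheme k) (n : ℕ) : ℕ :=
  Module.finrank k (homogeneousSubmodule (Fin 4) k n ⧸
    (Z.ideal.restrictScalars k).submoduleOf (homogeneousSubmodule (Fin 4) k n))

/-- `Z` is one-dimensional of degree `d`: its Hilbert polynomial is `d * n + c`, with `d > 0`. -/
def IsCurveOfDegree (Z : ClosedSubscheme k) (d : ℕ) : Prop :=
  0 < d ∧ ∃ c : ℤ, ∀ᶠ n : ℕ in atTop, (Z.hilbertFunction n : ℤ) = d * n + c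

/-- `Z` is an integral (irreducible and reduced) curve of degree `d`. -/
def IsIrreducibleCurveOfDegree (Z : ClosedSubscheme k) (d : ℕ) : Prop :=
  Z.ideal.IsPrime ∧ Z.IsCurveOfDegree d

/-- A line: the common zeros of two linearly independent linear forms. -/
def IsLine (Z : ClosedSubscheme k) : Prop :=
  ∃ l m : CoordRing k, l.IsHomogeneous 1 ∧ m.IsHomogeneous 1 ∧
    LinearIndependent k ![l, m] ∧ Z.IsCutOutBy {l, m}

/-- A doubled line: the conic in the plane `l = 0` that is given by the square of a linear form. -/
def IsDoubledLine (Z : ClosedSubscheme k) : Prop :=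
  ∃ l m : CoordRing k, l.IsHomogeneous 1 ∧ m.IsHomogeneous 1 ∧
    LinearIndependent k ![l, m] ∧ Z.IsCutOutBy {l, m ^ 2}

/-- A smooth conic (over an algebraically closed field): a plane section `l = q = 0` of a quadric,
with `l` and `q` satisfying the Jacobian criterion at every common zero. -/
def IsSmoothConic (Z : ClosedSubscheme k) : Prop :=
  ∃ l q : CoordRing k, l.IsHomogeneous 1 ∧ q.IsHomogeneous 2 ∧ Z.IsCutOutBy {l, q} ∧
    ∀ v : Fin 4 → k, v ≠ 0 → eval v l = 0 → eval v q = 0 →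
      LinearIndependent k ![fun i => eval v (pderiv i l), fun i => eval v (pderiv i q)]

/-- A twisted cubic: the image of `ℙ¹` under the map to `ℙ³` given by a basis of the binary cubic
forms. Its ideal consists of the polynomial relations between the four basis elements. -/
def IsTwistedCubic (Z : ClosedSubscheme k) : Prop :=
  ∃ f : Fin 4 → MvPolynomial (Fin 2) k, (∀ i, (f i).IsHomogeneous 3) ∧ LinearIndependent k f ∧
    Z.ideal = RingHom.ker (aeval f : CoordRing k →ₐ[k] MvPolynomial (Fin 2) k)

/-- `Z` is a multiplicity `m` structure on the reduced curve `C`: its support is `C` and its degree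
is `m` times the degree of `C`. -/
def IsMultipleStructureOn (Z : ClosedSubscheme k) (m : ℕ) (C : ClosedSubscheme k) : Prop :=
  Z.ideal.radical = C.ideal ∧ ∃ d : ℕ, C.IsCurveOfDegree d ∧ Z.IsCurveOfDegree (m * d)

end ClosedSubscheme

/-- `c` is the equation of a smooth conic in `ℙ²` (over an algebraically closed field). -/
def IsSmoothPlaneConic (c : MvPolynomial (Fin 3) k) : Prop :=
  c.IsHomogeneous 2 ∧
    ∀ v : Fin 3 → k, v ≠ 0 → eval v c = 0 → ∃ i, eval v (pderiv i c) ≠ 0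

/-- `Z` is a conic cone with cone point `p`: the pullback of a smooth conic `c = 0` in `ℙ²` along
the linear projection `(l 0 : l 1 : l 2)` from `ℙ³` to `ℙ²` with center `p`. -/
def ClosedSubscheme.IsConicCone (Z : ClosedSubscheme k) (p : ℙ k (Fin 4 → k)) : Prop :=
  ∃ (l : Fin 3 → CoordRing k) (c : MvPolynomial (Fin 3) k),
    (∀ i, (l i).IsHomogeneous 1) ∧ LinearIndependent k l ∧ (∀ i, eval p.rep (l i) = 0) ∧
      IsSmoothPlaneConic c ∧ Z.IsCutOutBy {aeval l c}

end ConicCones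

/-! A cone with vertex `p` has an equation `ξ₁ξ₂ = ξ₀²` in linear forms vanishing at `p`.

Suppose first that the vertex of `X₁` is off `X₂` (the other off-cone case is symmetric). Completing
the square turns `X₂` into `x² = q(ξ)` with `x` nonzero at the vertex, so the intersection is a
double cover of the base conic of `X₁`. Parametrizing this conic by `(st : s² : t²)`
(`ker_conicParam`) turns `q` into a binary quartic. The quartic is not zero, since otherwise `X₂`
would be a quadric of rank 1 or 4 instead of 3 (`not_forall_eval_eq_of_isCoords`). If it is not a
square, adjoining its square root gives a domain, so the intersection is integral
(`isPrime_span_of_not_isSquare`), of degree 4 as a complete intersection of two quadrics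
(`isCurveOfDegree_four`). If it is a square, its root comes from a linear form `r`, and the planes
`x = ±r` cut out two smooth conics (`conic_inf_conic`).

If each vertex lies on the other cone, the line joining them is a ruling of both
(`isConeIntersection_of_common_line`). When the tangent planes along it coincide, the intersection
is a smooth conic and the doubled line; otherwise it is a twisted cubic and the line. In both cases
suitable coordinates leave a single pair of equations, for which the identity of ideals is explicit
(`conic_inf_doubledLine`, `twistedCubic_inf_line`).

For the exclusions: the intersection always has enough points to lie in no plane
(`IsNondegenerate`), whereas the supports of a doubled conic and of a quadrupled line are planar. A
line on a cone passes through the vertex (`eval_eq_zero_of_isConicCone_contains`), so a line on both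
cones is the line joining the vertices. -/

namespace ConicCones

attribute [local instance] MvPolynomial.gradedAlgebra

variable {k : Type*} [Field k]

/-! ### Linear forms, quadratic forms and linear coordinates -/

section LinearForms

variable {m n : ℕ}

theorem exists_eq_sum_C_mul_X {p : MvPolynomial (Fin n) k} (hp : p.IsHomogeneous 1) :
    ∃ a : Fin n → k, p = ∑ j, C (a j) * X j := by
  rw [← mem_homogeneousSubmodule, homogeneousSubmodule_one_eq_span_X,
    Submodule.mem_span_range_iff_exists_fun] at hp
  obtain ⟨a, rfl⟩ := hp
  exact ⟨a, by simp [smul_eq_C_mul]⟩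

theorem isHomogeneous_sum_C_mul_X (a : Fin n → k) :
    (∑ j, C (a j) * X j : MvPolynomial (Fin n) k).IsHomogeneous 1 :=
  IsHomogeneous.sum _ _ _ fun _ _ => isHomogeneous_C_mul_X _ _

/-- The forms of degree 2 are spanned by products of two variables; averaging over the two orders
makes the coefficients symmetric, which needs division by 2. -/
theorem exists_eq_sum_C_mul_X_mul_X (h2 : (2 : k) ≠ 0) {p : MvPolynomial (Fin n) k}
    (hp : p.IsHomogeneous 2) :
    ∃ a : Fin n → Fin n → k, (∀ i j, a i j = a j i) ∧
      p = ∑ i, ∑ j, C (a i j) * X i * X j := by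
  have key : ∃ a : Fin n → Fin n → k, p = ∑ i, ∑ j, C (a i j) * X i * X j := by
    rw [← mem_homogeneousSubmodule, ← homogeneousSubmodule_one_pow,
      homogeneousSubmodule_one_eq_span_X, pow_two, Submodule.span_mul_span] at hp
    induction hp using Submodule.span_induction with
    | mem x hx =>
      obtain ⟨_, ⟨i, rfl⟩, _, ⟨j, rfl⟩, rfl⟩ := hx
      refine ⟨fun r s => if r = i ∧ s = j then 1 else 0, ?_⟩
      rw [Finset.sum_eq_single i (fun r _ hr => by simp [hr]) (by simp),
        Finset.sum_eq_single j (fun r _ hr => by simp [hr]) (by simp)]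
      simp
    | zero => exact ⟨0, by simp⟩
    | add x y _ _ hx hy =>
      obtain ⟨a, rfl⟩ := hx
      obtain ⟨b, rfl⟩ := hy
      exact ⟨a + b, by simp [add_mul, Finset.sum_add_distrib]⟩
    | smul c x _ hx =>
      obtain ⟨a, rfl⟩ := hx
      exact ⟨c • a, by simp [smul_eq_C_mul, Finset.mul_sum, mul_assoc]⟩
  obtain ⟨a, ha⟩ := key
  refine ⟨fun i j => (a i j + a j i) / 2, fun i j => by simp only [add_comm], ?_⟩
  have h3 : (C (2 : k) : MvPolynomial (Fin n) k) ≠ 0 := by simpa using h2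
  apply mul_left_cancel₀ h3
  calc C 2 * p = p + p := by rw [← two_mul, map_ofNat]
    _ = ∑ i, ∑ j, C (a i j) * X i * X j + ∑ i, ∑ j, C (a j i) * X j * X i := by
      nth_rw 1 [ha]; rw [ha]; congr 1; exact Finset.sum_comm
    _ = _ := by
      rw [Finset.mul_sum, ← Finset.sum_add_distrib]
      refine Finset.sum_congr rfl fun i _ => ?_
      rw [Finset.mul_sum, ← Finset.sum_add_distrib]
      refine Finset.sum_congr rfl fun j _ => ?_
      rw [← mul_assoc, ← mul_assoc, ← C_mul, mul_div_cancel₀ _ h2, C_add]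
      ring

/-- The coefficient matrix has independent rows, hence full row rank, hence defines a surjection. -/
theorem exists_forall_eval_eq {ξ : Fin m → MvPolynomial (Fin n) k}
    (hξ : ∀ i, (ξ i).IsHomogeneous 1) (hli : LinearIndependent k ξ) (u : Fin m → k) :
    ∃ v, ∀ i, eval v (ξ i) = u i := by
  choose a ha using fun i => exists_eq_sum_C_mul_X (hξ i)
  have hrow : LinearIndependent k (Matrix.of a).row := by
    rw [Fintype.linearIndependent_iff] at hli ⊢
    intro g hg
    refine hli g ?_
    have h := fun j => congrFun hg j
    simp only [Finset.sum_apply, Pi.smul_apply, Matrix.row, Matrix.of_apply, smul_eq_mul,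
      Pi.zero_apply] at h
    calc ∑ i, g i • ξ i = ∑ i, ∑ j, C (g i * a i j) * X j := by
          refine Finset.sum_congr rfl fun i _ => ?_
          rw [ha i, Finset.smul_sum]
          exact Finset.sum_congr rfl fun j _ => by rw [smul_eq_C_mul, C_mul, mul_assoc]
      _ = ∑ j, C (∑ i, g i * a i j) * X j := by
          rw [Finset.sum_comm]
          exact Finset.sum_congr rfl fun j _ => by rw [map_sum, Finset.sum_mul]
      _ = 0 := by simp [h]
  have hrk := hrow.rank_matrix
  have htop : LinearMap.range (Matrix.of a).mulVecLin = ⊤ := by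
    apply Submodule.eq_top_of_finrank_eq
    rw [← Matrix.rank, hrk]; simp
  obtain ⟨v, hv⟩ := LinearMap.range_eq_top.1 htop u
  refine ⟨v, fun i => ?_⟩
  have := congrFun hv i
  rw [ha i]
  simpa [Matrix.mulVec, dotProduct] using this

theorem linearIndependent_of_eval {ξ : Fin m → MvPolynomial (Fin n) k}
    (h : ∀ a : Fin m → k, (∀ v, ∑ i, a i * eval v (ξ i) = 0) → ∀ i, a i = 0) :
    LinearIndependent k ξ := by
  rw [Fintype.linearIndependent_iff]
  refine fun g hg => h g fun v => ?_
  simpa using congrArg (eval v) hg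

theorem eval_add_of_isHomogeneous_one {p : MvPolynomial (Fin n) k} (hp : p.IsHomogeneous 1)
    (u v : Fin n → k) : eval (u + v) p = eval u p + eval v p := by
  obtain ⟨a, rfl⟩ := exists_eq_sum_C_mul_X hp
  simp [mul_add, Finset.sum_add_distrib]

theorem eval_smul_of_isHomogeneous_one {p : MvPolynomial (Fin n) k} (hp : p.IsHomogeneous 1)
    (c : k) (v : Fin n → k) : eval (c • v) p = c * eval v p := by
  obtain ⟨a, rfl⟩ := exists_eq_sum_C_mul_X hp
  simp [Finset.mul_sum, mul_left_comm]

/-- Linear coordinates on `k ^ n`. -/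
def IsCoords (ξ : Fin n → MvPolynomial (Fin n) k) : Prop :=
  (∀ i, (ξ i).IsHomogeneous 1) ∧ LinearIndependent k ξ

theorem IsCoords.exists_algEquiv {ξ : Fin n → MvPolynomial (Fin n) k} (h : IsCoords ξ) :
    ∃ E : MvPolynomial (Fin n) k ≃ₐ[k] MvPolynomial (Fin n) k,
      (∀ i, E (X i) = ξ i) ∧ ∀ i, (E.symm (X i)).IsHomogeneous 1 := by
  choose a ha using fun i => exists_eq_sum_C_mul_X (h.1 i)
  -- The dual basis vectors `b j` are the columns of the inverse of the coefficient matrix, which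
  -- gives the inverse substitution.
  choose b hb using fun j => exists_forall_eval_eq h.1 h.2 (Pi.single j 1)
  have hab : Matrix.of a * (Matrix.of b).transpose = 1 := by
    ext i j
    have := hb j i
    rw [ha] at this
    rw [Matrix.one_apply, ← Pi.single_apply, ← this]
    simp [Matrix.mul_apply]
  have hba : (Matrix.of b).transpose * Matrix.of a = 1 := mul_eq_one_comm.1 hab
  have comp : ∀ a b : Fin n → Fin n → k, Matrix.of a * Matrix.of b = 1 → ∀ i,
      ∑ j, C (a i j) * ∑ l, C (b j l) * X l = (X i : MvPolynomial (Fin n) k) := by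
    intro a b hab i
    have : ∀ l, ∑ j, a i j * b j l = (1 : Matrix (Fin n) (Fin n) k) i l := fun l => by
      rw [← hab]; simp [Matrix.mul_apply]
    calc _ = ∑ l, C (∑ j, a i j * b j l) * X l := by
          simp only [Finset.mul_sum, map_sum, Finset.sum_mul]
          rw [Finset.sum_comm]
          simp [mul_assoc]
      _ = _ := by
          simp only [this, Matrix.one_apply]
          rw [Finset.sum_eq_single i (fun r _ hr => by simp [hr.symm]) (by simp)]
          simp
  refine ⟨AlgEquiv.ofAlgHom (aeval ξ) (aeval fun i => ∑ j, C (b j i) * X j) ?_ ?_, ?_, ?_⟩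
  · ext1 i
    simp only [AlgHom.comp_apply, aeval_X, map_sum, map_mul, algHom_C, algebraMap_eq, ha,
      AlgHom.id_apply]
    exact comp (fun i j => b j i) a hba i
  · ext1 i
    simp only [AlgHom.comp_apply, aeval_X, map_sum, map_mul, algHom_C, algebraMap_eq, ha,
      AlgHom.id_apply]
    exact comp a (fun i j => b j i) hab i
  · intro i; simp
  · intro i
    simpa using isHomogeneous_sum_C_mul_X fun j => b j i

theorem IsCoords.eq_zero {ξ : Fin n → MvPolynomial (Fin n) k} (h : IsCoords ξ) {v : Fin n → k}
    (hv : ∀ i, eval v (ξ i) = 0) : v = 0 := by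
  obtain ⟨E, hE, hE'⟩ := h.exists_algEquiv
  ext i
  obtain ⟨a, ha⟩ := exists_eq_sum_C_mul_X (hE' i)
  have := congrArg E ha
  simp only [AlgEquiv.apply_symm_apply, map_sum, map_mul, hE] at this
  have := congrArg (eval v) this
  rw [← algebraMap_eq] at this
  simp only [AlgEquiv.commutes] at this
  simpa [hv] using this

theorem IsCoords.exists_eq_sum {ξ : Fin n → MvPolynomial (Fin n) k} (h : IsCoords ξ)
    {p : MvPolynomial (Fin n) k} (hp : p.IsHomogeneous 1) :
    ∃ a : Fin n → k, p = ∑ i, C (a i) * ξ i := by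
  obtain ⟨E, hE, hE'⟩ := h.exists_algEquiv
  have h1 : (E.symm p).IsHomogeneous 1 := by
    obtain ⟨a, rfl⟩ := exists_eq_sum_C_mul_X hp
    rw [map_sum]
    refine IsHomogeneous.sum _ _ _ fun i _ => ?_
    rw [map_mul, ← algebraMap_eq, AlgEquiv.commutes, algebraMap_eq]
    exact (hE' i).C_mul _
  obtain ⟨a, ha⟩ := exists_eq_sum_C_mul_X h1
  refine ⟨a, ?_⟩
  have := congrArg E ha
  simpa only [AlgEquiv.apply_symm_apply, map_sum, map_mul, hE, ← algebraMap_eq,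
    AlgEquiv.commutes] using this

end LinearForms

/-! ### Saturation and subschemes cut out by forms -/

section Saturation

/-- Since a union has the intersection of the ideals, this reduces a decomposition of schemes to an
identity between ideals before saturation. -/
theorem saturation_inf (I J : Ideal (CoordRing k)) :
    saturation (I ⊓ J) = saturation I ⊓ saturation J := by
  refine le_antisymm (le_inf (saturation_mono inf_le_left) (saturation_mono inf_le_right)) ?_
  rintro f ⟨⟨m, hm⟩, n, hn⟩
  exact ⟨max m n, fun g hg => ⟨hm g (Ideal.pow_le_pow_right (le_max_left m n) hg),
    hn g (Ideal.pow_le_pow_right (le_max_right m n) hg)⟩⟩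

theorem saturation_sup_saturation (I J : Ideal (CoordRing k)) :
    saturation (saturation I ⊔ saturation J) = saturation (I ⊔ J) := by
  refine le_antisymm ?_ (saturation_mono (sup_le_sup (le_saturation I) (le_saturation J)))
  rw [← saturation_saturation (I ⊔ J)]
  exact saturation_mono (sup_le (saturation_mono le_sup_left) (saturation_mono le_sup_right))

/-- If a power of the irrelevant ideal multiplies `f` into `P`, so does a power of `l`, and that
power is not in the prime `P`. -/
theorem saturation_eq_self_of_isPrime {P : Ideal (CoordRing k)} (hP : P.IsPrime)
    {l : CoordRing k} (hl : l.IsHomogeneous 1) (hlP : l ∉ P) : saturation P = P := by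
  refine le_antisymm ?_ (le_saturation P)
  rintro f ⟨n, hn⟩
  refine (hP.mem_or_mem (hn (l ^ n) (Ideal.pow_mem_pow ?_ n))).resolve_left
    fun h => hlP (hP.mem_of_pow_mem n h)
  obtain ⟨a, rfl⟩ := exists_eq_sum_C_mul_X hl
  exact Ideal.sum_mem _ fun i _ => Ideal.mul_mem_left _ _ (Ideal.subset_span ⟨i, rfl⟩)

theorem eval_eq_zero_of_mem_saturation {I : Ideal (CoordRing k)} {v : Fin 4 → k} (hv : v ≠ 0)
    (hI : ∀ f ∈ I, eval v f = 0) {f : CoordRing k} (hf : f ∈ saturation I) : eval v f = 0 := by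
  obtain ⟨n, hn⟩ := hf
  obtain ⟨i, hi⟩ := Function.ne_iff.1 hv
  have := hI _ (hn (X i ^ n) (Ideal.pow_mem_pow (Ideal.subset_span (Set.mem_range_self i)) n))
  simpa [show v i ≠ 0 from hi] using this

theorem eval_eq_zero_of_mem_saturation_span {s : Set (CoordRing k)} {v : Fin 4 → k} (hv : v ≠ 0)
    (hs : ∀ f ∈ s, eval v f = 0) {f : CoordRing k} (hf : f ∈ saturation (Ideal.span s)) :
    eval v f = 0 := by
  refine eval_eq_zero_of_mem_saturation hv (fun g hg => ?_) hf
  have : Ideal.span s ≤ RingHom.ker (eval v) := Ideal.span_le.2 hs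
  exact this hg

namespace ClosedSubscheme

/-- The closed subscheme cut out by a set of homogeneous forms. -/
noncomputable def cutOut (s : Set (CoordRing k)) (hs : ∀ f ∈ s, ∃ n, f.IsHomogeneous n) :
    ClosedSubscheme k where
  ideal := saturation (Ideal.span s)
  homogeneous := saturation_isHomogeneous (Ideal.homogeneous_span _ _ hs)
  saturated := saturation_saturation _

theorem isCutOutBy_inter {Y Z : ClosedSubscheme k} {f g : CoordRing k}
    (hY : Y.IsCutOutBy {f}) (hZ : Z.IsCutOutBy {g}) : (Y.inter Z).IsCutOutBy {f, g} := by
  change saturation (Y.ideal ⊔ Z.ideal) = _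
  rw [hY, hZ, saturation_sup_saturation, ← Ideal.span_union, Set.singleton_union]

end ClosedSubscheme

end Saturation

/-! ### Parametrized curves and their ideals -/

section Kernels

theorem coeff_monomial_mul_expand_eq_zero {σ : Type*} {p : ℕ} {d m : σ →₀ ℕ}
    (h : ∃ i, ¬ m i ≡ d i [MOD p]) (b : MvPolynomial σ k) :
    coeff m (monomial d 1 * expand p b) = 0 := by
  obtain ⟨i, hi⟩ := h
  rw [coeff_monomial_mul']
  split_ifs with hdm
  · rw [one_mul]
    refine coeff_expand_of_not_dvd _ (i := i) fun hdvd => hi ?_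
    rw [Finsupp.tsub_apply] at hdvd
    exact ((Nat.modEq_iff_dvd' (hdm i)).2 hdvd).symm
  · rfl

/-- All exponents in `x ^ d * b(x ^ p)` are congruent to `d` modulo `p`, so different summands share
no monomial and cannot cancel. -/
theorem eq_zero_of_sum_monomial_mul_expand_eq_zero {σ ι : Type*} [Fintype ι] {p : ℕ} (hp : p ≠ 0)
    {d : ι → σ →₀ ℕ} (hd : ∀ i j, i ≠ j → ∃ r, ¬ d i r ≡ d j r [MOD p])
    {b : ι → MvPolynomial σ k} (h : ∑ i, monomial (d i) 1 * expand p (b i) = 0) (i : ι) :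
    b i = 0 := by
  classical
  ext m
  have := congrArg (coeff (d i + p • m)) h
  rw [coeff_sum, Finset.sum_eq_single i, coeff_monomial_mul, one_mul, coeff_expand_smul _ hp] at this
  · simpa using this
  · intro j _ hj
    refine coeff_monomial_mul_expand_eq_zero ?_ _
    obtain ⟨r, hr⟩ := hd i j hj.symm
    refine ⟨r, fun h => hr (Nat.ModEq.trans ?_ h)⟩
    simp [Nat.ModEq]
  · simp

variable {n : ℕ}

/-- Division by `X₀² - q`, which is monic in `X₀`: the remainder has degree at most 1 in `X₀`. -/
theorem exists_sub_add_X_zero_mul_mem_span (q : MvPolynomial (Fin n) k)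
    (p : MvPolynomial (Fin (n + 1)) k) :
    ∃ a b : MvPolynomial (Fin n) k,
      p - (rename Fin.succ a + X 0 * rename Fin.succ b) ∈
        Ideal.span {X 0 ^ 2 - rename Fin.succ q} := by
  induction p using MvPolynomial.induction_on with
  | C c => exact ⟨C c, 0, by simp⟩
  | add p₁ p₂ h₁ h₂ =>
    obtain ⟨a₁, b₁, h₁⟩ := h₁
    obtain ⟨a₂, b₂, h₂⟩ := h₂
    refine ⟨a₁ + a₂, b₁ + b₂, ?_⟩
    convert Ideal.add_mem _ h₁ h₂ using 1
    simp only [map_add]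
    ring
  | mul_X p i h =>
    obtain ⟨a, b, h⟩ := h
    refine Fin.cases ?_ (fun i => ?_) i
    · refine ⟨q * b, a, ?_⟩
      convert Ideal.add_mem _ (Ideal.mul_mem_right (X 0) _ h)
        (Ideal.mul_mem_left _ (rename Fin.succ b) (Ideal.mem_span_singleton_self _)) using 1
      simp only [map_mul]
      ring
    · refine ⟨a * X i, b * X i, ?_⟩
      convert Ideal.mul_mem_right (X i.succ) _ h using 1
      simp only [map_mul, rename_X]
      ring

theorem sub_rename_aeval_cons_mem_span (r : MvPolynomial (Fin n) k)
    (p : MvPolynomial (Fin (n + 1)) k) :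
    p - rename Fin.succ (aeval (Fin.cons r X : Fin (n + 1) → MvPolynomial (Fin n) k) p) ∈
      Ideal.span {X 0 - rename Fin.succ r} := by
  rw [← Ideal.Quotient.eq]
  have : Ideal.Quotient.mkₐ k (Ideal.span {X 0 - rename Fin.succ r}) =
      (Ideal.Quotient.mkₐ k (Ideal.span {X 0 - rename Fin.succ r})).comp
        ((rename Fin.succ).comp (aeval (Fin.cons r X))) := by
    ext1 i
    refine Fin.cases ?_ (fun i => ?_) i
    · simp only [Ideal.Quotient.mkₐ_eq_mk, AlgHom.comp_apply, aeval_X, Fin.cons_zero]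
      rw [Ideal.Quotient.eq]
      exact Ideal.mem_span_singleton_self _
    · simp
  exact DFunLike.congr_fun this p

/-- The parametrization `(st : s² : t²)` of the plane conic `X₀² = X₁ X₂`. -/
noncomputable def conicParam (k : Type*) [Field k] :
    MvPolynomial (Fin 3) k →ₐ[k] MvPolynomial (Fin 2) k :=
  aeval ![X 0 * X 1, X 0 ^ 2, X 1 ^ 2]

/-- Modulo the conic a polynomial is `a(X₁, X₂) + X₀ b(X₁, X₂)`, with image `a(s², t²) + st b(s²,
t²)`. The two terms are separated by the parity of the exponents, so both vanish. -/
theorem ker_conicParam :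
    RingHom.ker (conicParam k) = Ideal.span {X 0 ^ 2 - X 1 * X 2} := by
  have hle : Ideal.span {X 0 ^ 2 - X 1 * X 2} ≤ RingHom.ker (conicParam k) := by
    rw [Ideal.span_singleton_le_iff_mem, RingHom.mem_ker]
    simp [conicParam]
    ring
  refine le_antisymm (fun p hp => ?_) hle
  obtain ⟨a, b, hab⟩ := exists_sub_add_X_zero_mul_mem_span (X 0 * X 1 : MvPolynomial (Fin 2) k) p
  have hg : (X 0 ^ 2 - rename Fin.succ (X 0 * X 1 : MvPolynomial (Fin 2) k)) =
      (X 0 ^ 2 - X 1 * X 2 : MvPolynomial (Fin 3) k) := by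
    simp
  rw [hg] at hab
  have hren : (conicParam k).comp (rename Fin.succ) = expand 2 := by
    ext1 i
    fin_cases i <;> simp [conicParam]
  have hren' := fun a => DFunLike.congr_fun hren a
  simp only [AlgHom.comp_apply] at hren'
  have h0 := hle hab
  rw [RingHom.mem_ker] at hp h0
  simp only [map_sub, hp, map_add, map_mul, hren', zero_sub, neg_eq_zero] at h0
  have hX : conicParam k (X 0) = monomial (Finsupp.single 0 1 + Finsupp.single 1 1) 1 := by
    rw [conicParam, aeval_X]
    simp [X, monomial_mul]
  have := eq_zero_of_sum_monomial_mul_expand_eq_zero (k := k) (p := 2) two_ne_zero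
    (d := ![0, Finsupp.single (0 : Fin 2) 1 + Finsupp.single 1 1]) (b := ![a, b]) (by
      intro i j hij
      refine ⟨0, ?_⟩
      fin_cases i <;> fin_cases j <;> simp_all [Nat.ModEq]) (by
      rw [hX] at h0
      simpa [Fin.sum_univ_two] using h0)
  have ha := this 0
  have hb := this 1
  simp only [Matrix.cons_val_zero, Matrix.cons_val_one] at ha hb
  simpa [ha, hb] using hab

theorem ker_conicParam_comp (r : MvPolynomial (Fin 3) k) :
    RingHom.ker ((conicParam k).comp (aeval (Fin.cons r X : Fin 4 → MvPolynomial (Fin 3) k))) =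
      Ideal.span {X 0 - rename Fin.succ r, X 1 ^ 2 - X 2 * X 3} := by
  have hq : rename Fin.succ (X 0 ^ 2 - X 1 * X 2 : MvPolynomial (Fin 3) k) =
      (X 1 ^ 2 - X 2 * X 3 : CoordRing k) := by
    simp
  have hcons : ∀ p : MvPolynomial (Fin 3) k,
      aeval (Fin.cons r X : Fin 4 → MvPolynomial (Fin 3) k) (rename Fin.succ p) = p := by
    intro p
    rw [aeval_rename]
    simp [Function.comp_def]
  refine le_antisymm (fun p hp => ?_) ?_
  · rw [RingHom.mem_ker, AlgHom.comp_apply, ← RingHom.mem_ker, ker_conicParam,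
      Ideal.mem_span_singleton] at hp
    obtain ⟨c, hc⟩ := hp
    have := sub_rename_aeval_cons_mem_span r p
    rw [hc, map_mul, hq] at this
    have h1 : Ideal.span {X 0 - rename Fin.succ r} ≤
        Ideal.span {X 0 - rename Fin.succ r, (X 1 ^ 2 - X 2 * X 3 : CoordRing k)} :=
      Ideal.span_mono (by simp)
    have h2 : (X 1 ^ 2 - X 2 * X 3 : CoordRing k) * rename Fin.succ c ∈
        Ideal.span {X 0 - rename Fin.succ r, (X 1 ^ 2 - X 2 * X 3 : CoordRing k)} :=
      Ideal.mul_mem_right _ _ (Ideal.subset_span (by simp))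
    simpa using Ideal.add_mem _ (h1 this) h2
  · rw [Ideal.span_le]
    rintro _ (rfl | rfl)
    · change _ = _
      rw [AlgHom.comp_apply, map_sub, hcons, aeval_X, Fin.cons_zero, sub_self, map_zero]
    · rw [← hq]
      change _ = _
      rw [AlgHom.comp_apply, hcons, ← RingHom.mem_ker, ker_conicParam]
      exact Ideal.mem_span_singleton_self _

/-- The relation makes `δ` a fraction with denominator `b`, so `f b² = a²`; over an integrally
closed domain `b² ∣ a²` gives `b ∣ a`, and the quotient is a square root of `f`. -/
theorem exists_sq_eq_of_algebraMap_add_mul_eq_zero {A D : Type*} [CommRing A] [IsDomain A]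
    [IsIntegrallyClosed A] [Field D] [Algebra A D] [FaithfulSMul A D] {f a b : A} {δ : D}
    (hδ : δ ^ 2 = algebraMap A D f) (hab : algebraMap A D a + δ * algebraMap A D b = 0)
    (hb : b ≠ 0) : ∃ c, c ^ 2 = f := by
  have h : f * b ^ 2 = a ^ 2 := by
    apply FaithfulSMul.algebraMap_injective A D
    rw [map_mul, map_pow, map_pow, ← hδ]
    linear_combination (δ * algebraMap A D b - algebraMap A D a) * hab
  obtain ⟨c, rfl⟩ := (IsIntegrallyClosed.pow_dvd_pow_iff two_ne_zero).1 (Dvd.intro_left f h)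
  refine ⟨c, ?_⟩
  have hb2 : b ^ 2 ≠ 0 := pow_ne_zero _ hb
  apply mul_right_cancel₀ hb2
  rw [h]; ring

/-- The ideal is the kernel of a map to a field: parametrize the conic and send `X₀` to a square
root `δ` of the quartic. A relation `a + δ b = 0` over `k[s, t]` with `b ≠ 0` would make the quartic
a square. -/
theorem isPrime_span_of_not_isSquare {q : MvPolynomial (Fin 3) k}
    (hq : ¬ ∃ c, c ^ 2 = conicParam k q) :
    (Ideal.span {X 1 ^ 2 - X 2 * X 3, X 0 ^ 2 - rename Fin.succ q} : Ideal (CoordRing k)).IsPrime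
      := by
  let D := AlgebraicClosure (FractionRing (MvPolynomial (Fin 2) k))
  have : FaithfulSMul (MvPolynomial (Fin 2) k) D :=
    FaithfulSMul.trans _ (FractionRing (MvPolynomial (Fin 2) k)) _
  let ι : MvPolynomial (Fin 2) k →ₐ[k] D := IsScalarTower.toAlgHom k _ _
  obtain ⟨δ, hδ⟩ := IsAlgClosed.exists_pow_nat_eq (ι (conicParam k q)) zero_lt_two
  let Φ : CoordRing k →ₐ[k] D := aeval (Fin.cons δ fun i => ι (conicParam k (X i)))
  have hΦ : ∀ p, Φ (rename Fin.succ p) = ι (conicParam k p) := by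
    have : Φ.comp (rename Fin.succ) = ι.comp (conicParam k) := by
      ext1 i
      simp [Φ]
    exact fun p => DFunLike.congr_fun this p
  have hg : rename Fin.succ (X 0 ^ 2 - X 1 * X 2 : MvPolynomial (Fin 3) k) =
      (X 1 ^ 2 - X 2 * X 3 : CoordRing k) := by
    simp
  set I : Ideal (CoordRing k) := Ideal.span {X 1 ^ 2 - X 2 * X 3, X 0 ^ 2 - rename Fin.succ q}
  have hX : Φ (X 0) = δ := by simp [Φ]
  have hle : I ≤ RingHom.ker Φ := by
    refine Ideal.span_le.2 ?_
    rintro _ (rfl | rfl)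
    · rw [← hg]
      change _ = _
      rw [hΦ, (RingHom.mem_ker (f := conicParam k)).1, map_zero]
      rw [ker_conicParam]
      exact Ideal.mem_span_singleton_self _
    · change _ = _
      rw [map_sub, map_pow, hX, hΦ, hδ, sub_self]
  have hcon : ∀ a, conicParam k a = 0 → rename Fin.succ a ∈ I := by
    intro a ha
    rw [← RingHom.mem_ker, ker_conicParam, Ideal.mem_span_singleton] at ha
    obtain ⟨c, rfl⟩ := ha
    rw [map_mul, hg]
    exact Ideal.mul_mem_right _ _ (Ideal.subset_span (by simp))
  have : I = RingHom.ker Φ := by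
    refine le_antisymm hle fun p hp => ?_
    obtain ⟨a, b, hab⟩ := exists_sub_add_X_zero_mul_mem_span q p
    have hab : p - (rename Fin.succ a + X 0 * rename Fin.succ b) ∈ I :=
      Ideal.span_mono (by simp) hab
    have h0 := hle hab
    rw [RingHom.mem_ker] at hp h0
    simp only [map_sub, hp, map_add, map_mul, hΦ, hX, zero_sub, neg_eq_zero] at h0
    have hb : conicParam k b = 0 := by
      by_contra hb
      exact hq (exists_sq_eq_of_algebraMap_add_mul_eq_zero hδ h0 hb)
    rw [hb, map_zero, mul_zero, add_zero] at h0
    have ha : conicParam k a = 0 := FaithfulSMul.algebraMap_injective _ D (h0.trans (map_zero _).symm)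
    have := I.add_mem hab (I.add_mem (hcon a ha) (I.mul_mem_left (X 0) (hcon b hb)))
    simpa using this
  rw [this]
  exact RingHom.ker_isPrime _

/-- The parametrization `(s³ : t³ : s²t : st²)` of the twisted cubic. -/
noncomputable def cubicParam (k : Type*) [Field k] : Fin 4 → MvPolynomial (Fin 2) k :=
  ![X 0 ^ 3, X 1 ^ 3, X 0 ^ 2 * X 1, X 0 * X 1 ^ 2]

/-- Modulo the three quadrics every polynomial is `a + X₂ b + X₃ c` with `a`, `b`, `c` in `X₀`,
`X₁`. The images of the three terms have exponents in different classes modulo 3. -/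
theorem ker_cubicParam :
    RingHom.ker (aeval (cubicParam k) : CoordRing k →ₐ[k] _) =
      Ideal.span {X 1 * X 2 - X 3 ^ 2, X 0 * X 3 - X 2 ^ 2, X 0 * X 1 - X 2 * X 3} := by
  set T : Ideal (CoordRing k) :=
    Ideal.span {X 1 * X 2 - X 3 ^ 2, X 0 * X 3 - X 2 ^ 2, X 0 * X 1 - X 2 * X 3} with hT
  have h1 : X 1 * X 2 - X 3 ^ 2 ∈ T := Ideal.subset_span (by simp)
  have h2 : X 0 * X 3 - X 2 ^ 2 ∈ T := Ideal.subset_span (by simp)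
  have h3 : X 0 * X 1 - X 2 * X 3 ∈ T := Ideal.subset_span (by simp)
  have hle : T ≤ RingHom.ker (aeval (cubicParam k) : CoordRing k →ₐ[k] _) := by
    rw [hT, Ideal.span_le]
    rintro _ (rfl | rfl | rfl) <;> change _ = _ <;> simp [cubicParam] <;> ring
  refine le_antisymm (fun p hp => ?_) hle
  let ι : MvPolynomial (Fin 2) k →ₐ[k] CoordRing k := rename ![0, 1]
  have hι0 : ι (X 0) = X 0 := by simp [ι]
  have hι1 : ι (X 1) = X 1 := by simp [ι]
  have key : ∃ a b c, p - (ι a + X 2 * ι b + X 3 * ι c) ∈ T := by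
    clear hp
    induction p using MvPolynomial.induction_on with
    | C c => exact ⟨C c, 0, 0, by simp [ι]⟩
    | add p₁ p₂ h₁ h₂ =>
      obtain ⟨a₁, b₁, c₁, h₁⟩ := h₁
      obtain ⟨a₂, b₂, c₂, h₂⟩ := h₂
      refine ⟨a₁ + a₂, b₁ + b₂, c₁ + c₂, ?_⟩
      convert T.add_mem h₁ h₂ using 1
      simp only [map_add]
      ring
    | mul_X p i h =>
      obtain ⟨a, b, c, h⟩ := h
      fin_cases i
      · refine ⟨a * X 0, b * X 0, c * X 0, ?_⟩
        convert T.mul_mem_right (X 0) h using 1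
        simp only [map_mul, hι0, Fin.zero_eta]
        ring
      · refine ⟨a * X 1, b * X 1, c * X 1, ?_⟩
        convert T.mul_mem_right (X 1) h using 1
        simp only [map_mul, hι1, Fin.mk_one]
        ring
      -- Reduction by `X₂² = X₀X₃` and `X₂X₃ = X₀X₁`; the next case also uses `X₃² = X₁X₂`.
      · refine ⟨X 0 * X 1 * c, a, X 0 * b, ?_⟩
        convert T.sub_mem (T.sub_mem (T.mul_mem_right (X 2) h) (T.mul_mem_left (ι b) h2))
          (T.mul_mem_left (ι c) h3) using 1
        simp only [map_mul, hι0, hι1, Fin.reduceFinMk]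
        ring
      · refine ⟨X 0 * X 1 * b, X 1 * c, a, ?_⟩
        convert T.sub_mem (T.sub_mem (T.mul_mem_right (X 3) h) (T.mul_mem_left (ι c) h1))
          (T.mul_mem_left (ι b) h3) using 1
        simp only [map_mul, hι0, hι1, Fin.reduceFinMk]
        ring
  obtain ⟨a, b, c, habc⟩ := key
  have hren : (aeval (cubicParam k) : CoordRing k →ₐ[k] _).comp ι = expand 3 := by
    ext1 i
    fin_cases i <;> simp [cubicParam, ι]
  have hren' := fun a => DFunLike.congr_fun hren a
  simp only [AlgHom.comp_apply] at hren'
  have h0 := hle habc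
  rw [RingHom.mem_ker] at hp h0
  simp only [map_sub, hp, map_add, map_mul, hren', zero_sub, neg_eq_zero] at h0
  have hX2 : (aeval (cubicParam k) (X 2 : CoordRing k)) =
      monomial (Finsupp.single 0 2 + Finsupp.single 1 1) 1 := by
    rw [aeval_X]
    simp [cubicParam, X, monomial_mul, monomial_pow]
  have hX3 : (aeval (cubicParam k) (X 3 : CoordRing k)) =
      monomial (Finsupp.single 0 1 + Finsupp.single 1 2) 1 := by
    rw [aeval_X]
    simp [cubicParam, X, monomial_mul, monomial_pow]
  have := eq_zero_of_sum_monomial_mul_expand_eq_zero (k := k) (p := 3) three_ne_zero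
    (d := ![0, Finsupp.single (0 : Fin 2) 2 + Finsupp.single 1 1,
      Finsupp.single (0 : Fin 2) 1 + Finsupp.single 1 2]) (b := ![a, b, c]) (by
      intro i j hij
      refine ⟨0, ?_⟩
      fin_cases i <;> fin_cases j <;> simp_all [Nat.ModEq]) (by
      rw [hX2, hX3] at h0
      simpa [Fin.sum_univ_three] using h0)
  have ha := this 0
  have hb := this 1
  have hc := this 2
  simp only [Matrix.cons_val] at ha hb hc
  simpa [ha, hb, hc] using habc

end Kernels

/-! ### The Hilbert function of a complete intersection of two quadrics -/

section HilbertFunction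

theorem finrank_homogeneousSubmodule (n : ℕ) :
    Module.finrank k (homogeneousSubmodule (Fin 4) k n) = (n + 3).choose 3 := by
  have e : {d : Fin 4 →₀ ℕ | d.degree = n} ≃ Sym (Fin 4) n :=
    (Equiv.subtypeEquivRight fun d => by simp [Finsupp.degree_apply, Finsupp.sum]).trans
      (Sym.equivNatSum (Fin 4) n).symm
  rw [homogeneousSubmodule_eq_finsupp_supported]
  have : Fintype {d : Fin 4 →₀ ℕ | d.degree = n} := Fintype.ofEquiv _ e.symm
  rw [LinearEquiv.finrank_eq
      (AddMonoidAlgebra.supportedEquivFinsupp {d : Fin 4 →₀ ℕ | d.degree = n}),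
    Module.finrank_finsupp_self, Fintype.card_congr e, Sym.card_sym_eq_choose]
  simp only [Fintype.card_fin]
  rw [show 4 + n - 1 = n + 3 by omega, ← Nat.choose_symm_add]

instance finite_homogeneousSubmodule (n : ℕ) :
    Module.Finite k (homogeneousSubmodule (Fin 4) k n) :=
  Module.Finite.iff_fg.2 (homogeneousSubmodule_fg _ _ n)

theorem homogeneousComponent_mul_of_isHomogeneous {σ : Type*} {f : MvPolynomial σ k} {m : ℕ}
    (hf : f.IsHomogeneous m) (p : MvPolynomial σ k) (n : ℕ) :
    homogeneousComponent (n + m) (p * f) = homogeneousComponent n p * f := by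
  classical
  have := DirectSum.coe_decompose_mul_add_of_right_mem (homogeneousSubmodule σ k) (i := n) (a := p)
    hf
  have e : ∀ (p : MvPolynomial σ k) i,
      (DirectSum.decompose (homogeneousSubmodule σ k) p i : MvPolynomial σ k) =
        homogeneousComponent i p := decomposition.decompose'_apply
  rwa [e, e] at this

/-- By `hfg`, `g` is a nonzerodivisor modulo `f`, so a common multiple of `f` and `g` is a multiple
of `f * g`. The cofactor need not be homogeneous, and is replaced by its component of degree `n`. -/
theorem map_mulRight_inf {f g : CoordRing k} {d : ℕ} (hf : f.IsHomogeneous d)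
    (hg : g.IsHomogeneous d) (hfg : ∀ h, f ∣ g * h → f ∣ h) (n : ℕ) :
    (homogeneousSubmodule (Fin 4) k (n + d)).map (LinearMap.mulRight k f) ⊓
      (homogeneousSubmodule (Fin 4) k (n + d)).map (LinearMap.mulRight k g) =
      (homogeneousSubmodule (Fin 4) k n).map (LinearMap.mulRight k (f * g)) := by
  apply le_antisymm
  · rintro _ ⟨⟨a, ha, rfl⟩, b, hb, hab⟩
    simp only [LinearMap.mulRight_apply] at hab
    obtain ⟨c, rfl⟩ := hfg b ⟨a, by rw [mul_comm, hab, mul_comm]⟩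
    refine ⟨homogeneousComponent n c, homogeneousComponent_isHomogeneous _ _, ?_⟩
    have h1 := homogeneousComponent_mul_of_isHomogeneous hf c n
    rw [mul_comm c, homogeneousComponent_eq_self hb] at h1
    simp only [LinearMap.mulRight_apply]
    rw [← hab, h1]
    ring
  · rintro _ ⟨c, hc, rfl⟩
    refine ⟨⟨c * g, hc.mul hg, ?_⟩, c * f, hc.mul hf, ?_⟩ <;>
      simp only [LinearMap.mulRight_apply] <;> ring

theorem span_pair_inf_homogeneousSubmodule {f g : CoordRing k} {d : ℕ} (hf : f.IsHomogeneous d)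
    (hg : g.IsHomogeneous d) (n : ℕ) :
    (Ideal.span {f, g}).restrictScalars k ⊓ homogeneousSubmodule (Fin 4) k (n + d) =
      (homogeneousSubmodule (Fin 4) k n).map (LinearMap.mulRight k f) ⊔
        (homogeneousSubmodule (Fin 4) k n).map (LinearMap.mulRight k g) := by
  apply le_antisymm
  · rintro p ⟨hp, hpn⟩
    obtain ⟨a, b, rfl⟩ := Ideal.mem_span_pair.1 hp
    rw [← homogeneousComponent_eq_self hpn, map_add, homogeneousComponent_mul_of_isHomogeneous hf,
      homogeneousComponent_mul_of_isHomogeneous hg]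
    exact Submodule.add_mem_sup ⟨_, homogeneousComponent_isHomogeneous _ _, rfl⟩
      ⟨_, homogeneousComponent_isHomogeneous _ _, rfl⟩
  · refine sup_le ?_ ?_
    · rintro _ ⟨a, ha, rfl⟩
      exact ⟨Ideal.mul_mem_left _ _ (Ideal.subset_span (by simp)), ha.mul hf⟩
    · rintro _ ⟨a, ha, rfl⟩
      exact ⟨Ideal.mul_mem_left _ _ (Ideal.subset_span (by simp)), ha.mul hg⟩

theorem finrank_map_mulRight {f : CoordRing k} (hf : f ≠ 0) (n : ℕ) :
    Module.finrank k ((homogeneousSubmodule (Fin 4) k n).map (LinearMap.mulRight k f)) =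
      (n + 3).choose 3 := by
  rw [← finrank_homogeneousSubmodule (k := k) n]
  refine (LinearEquiv.finrank_eq (Submodule.equivMapOfInjective _ ?_ _)).symm
  exact fun a b h => mul_right_cancel₀ hf h

/-- In degree `N` the ideal is the sum of the multiples of `f` and of `g`, which meet in the
multiples of `f * g`. Counting dimensions gives `C(N+3,3) - 2 C(N+1,3) + C(N-1,3) = 4N`, so the
constant term is 0. -/
theorem ClosedSubscheme.isCurveOfDegree_four {Z : ClosedSubscheme k} {f g : CoordRing k}
    (hf : f.IsHomogeneous 2) (hg : g.IsHomogeneous 2) (hf0 : f ≠ 0) (hg0 : g ≠ 0)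
    (hfg : ∀ h, f ∣ g * h → f ∣ h) (hZ : Z.ideal = Ideal.span {f, g}) : Z.IsCurveOfDegree 4 := by
  refine ⟨by norm_num, 0, ?_⟩
  filter_upwards [eventually_ge_atTop 4] with N hN
  obtain ⟨n, rfl⟩ := Nat.exists_eq_add_of_le' hN
  have h1 := Submodule.finrank_quotient_add_finrank
    ((Z.ideal.restrictScalars k).submoduleOf (homogeneousSubmodule (Fin 4) k (n + 4)))
  rw [finrank_homogeneousSubmodule] at h1
  have h2 : Module.finrank k
      ((Z.ideal.restrictScalars k).submoduleOf (homogeneousSubmodule (Fin 4) k (n + 4))) =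
      Module.finrank k ((Ideal.span {f, g}).restrictScalars k ⊓
        homogeneousSubmodule (Fin 4) k (n + 2 + 2) : Submodule k (CoordRing k)) := by
    rw [← Submodule.finrank_map_subtype_eq, Submodule.submoduleOf, Submodule.map_comap_subtype,
      inf_comm, hZ]
  have h3 := Submodule.finrank_sup_add_finrank_inf_eq
    ((homogeneousSubmodule (Fin 4) k (n + 2)).map (LinearMap.mulRight k f))
    ((homogeneousSubmodule (Fin 4) k (n + 2)).map (LinearMap.mulRight k g))
  rw [map_mulRight_inf hf hg hfg, ← span_pair_inf_homogeneousSubmodule hf hg,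
    finrank_map_mulRight (mul_ne_zero hf0 hg0), finrank_map_mulRight hf0,
    finrank_map_mulRight hg0] at h3
  change ((Module.finrank k _ : ℕ) : ℤ) = _
  rw [h2] at h1
  have e : ∀ m : ℕ, 6 * (m + 3).choose 3 = (m + 3) * (m + 2) * (m + 1) := by
    intro m
    have := Nat.descFactorial_eq_factorial_mul_choose (m + 3) 3
    simp only [Nat.descFactorial, Nat.factorial] at this
    norm_num at this
    rw [← this, show m + 3 - 2 = m + 1 by omega]
    ring
  have e0 := e n
  have e2 := e (n + 2)
  have e4 := e (n + 4)
  zify at h1 h3 e0 e2 e4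
  push_cast
  linarith

end HilbertFunction

/-! ### Normal forms of smooth conics and conic cones -/

section NormalForm

theorem exists_isHomogeneous_one_eval_eq {n : ℕ} (φ : (Fin n → k) →ₗ[k] k) :
    ∃ p : MvPolynomial (Fin n) k, p.IsHomogeneous 1 ∧ ∀ v, eval v p = φ v := by
  refine ⟨∑ j, C (φ (Pi.single j 1)) * X j, isHomogeneous_sum_C_mul_X _, fun v => ?_⟩
  rw [LinearMap.pi_apply_eq_sum_univ φ v]
  have : ∀ i, (fun j => if i = j then 1 else 0 : Fin n → k) = Pi.single i 1 := fun i => by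
    ext j
    simp [Pi.single_apply, eq_comm]
  simp [mul_comm, this]

theorem linearIndependent_of_forall_exists_eval {m n : ℕ} {ξ : Fin m → MvPolynomial (Fin n) k}
    (h : ∀ i, ∃ v, eval v (ξ i) = 1 ∧ ∀ j, j ≠ i → eval v (ξ j) = 0) :
    LinearIndependent k ξ := by
  refine linearIndependent_of_eval fun a ha i => ?_
  obtain ⟨v, hv, hv'⟩ := h i
  have := ha v
  rwa [Finset.sum_eq_single i (fun j _ hj => by rw [hv' j hj, mul_zero]) (by simp), hv,
    mul_one] at this

/-- The gradient of `c` at `v` is twice `B v`. A vector in the radical of `B` would thus be a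
singular point of the conic. -/
theorem IsSmoothPlaneConic.exists_bilin (h2 : (2 : k) ≠ 0) {c : MvPolynomial (Fin 3) k}
    (hc : IsSmoothPlaneConic c) :
    ∃ B : LinearMap.BilinForm k (Fin 3 → k), (∀ u v, B u v = B v u) ∧ (∀ v, eval v c = B v v) ∧
      ∀ v, v ≠ 0 → ∃ u, B v u ≠ 0 := by
  obtain ⟨a, hsymm, ha⟩ := exists_eq_sum_C_mul_X_mul_X h2 hc.1
  have hB : ∀ u v, Matrix.toBilin' (Matrix.of a) u v = ∑ i, ∑ j, u i * a i j * v j :=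
    fun u v => Matrix.toBilin'_apply _ _ _
  have hev : ∀ v, eval v c = Matrix.toBilin' (Matrix.of a) v v := by
    intro v
    rw [hB, ha]
    simp only [map_sum, map_mul, eval_C, eval_X]
    exact Finset.sum_congr rfl fun i _ => Finset.sum_congr rfl fun j _ => by ring
  refine ⟨Matrix.toBilin' (Matrix.of a), fun u v => ?_, hev, fun v hv => ?_⟩
  · rw [hB, hB, Finset.sum_comm]
    exact Finset.sum_congr rfl fun i _ => Finset.sum_congr rfl fun j _ => by rw [hsymm j i]; ring
  · by_contra! h
    obtain ⟨i, hi⟩ := hc.2 v hv (by rw [hev, h])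
    apply hi
    have hz := h (Pi.single i 1)
    rw [hB] at hz
    simp only [Pi.single_apply, mul_ite, mul_one, mul_zero, Finset.sum_ite_eq',
      Finset.mem_univ, if_true] at hz
    have : eval v (pderiv i c) = 2 * ∑ j, v j * a j i := by
      rw [ha]
      simp only [map_sum, Derivation.leibniz, pderiv_C, pderiv_X, smul_eq_mul, map_add, map_mul,
        eval_C, eval_X, mul_zero, add_zero, Pi.single_apply, Finset.sum_add_distrib]
      simp only [apply_ite (eval v), map_one, map_zero, mul_ite, mul_one, mul_zero,
        Finset.sum_ite_eq', Finset.sum_ite_irrel, Finset.mem_univ, if_true, two_mul,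
        Finset.sum_const_zero]
      congr 1
      · exact Finset.sum_congr rfl fun j _ => by ring
      · exact Finset.sum_congr rfl fun j _ => by rw [hsymm i j]
    rw [this, hz, mul_zero]

/-- The isotropic vector `v` is completed to a hyperbolic pair `v`, `u`, and the plane splits off
with an orthogonal vector `n` scaled to `B n n = -1`. The forms `η` are the coordinates in this
basis. -/
theorem IsSmoothPlaneConic.exists_eq [IsAlgClosed k] (h2 : (2 : k) ≠ 0)
    {c : MvPolynomial (Fin 3) k} (hc : IsSmoothPlaneConic c) {v : Fin 3 → k} (hv : v ≠ 0)
    (hvc : eval v c = 0) :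
    ∃ η : Fin 3 → MvPolynomial (Fin 3) k, (∀ i, (η i).IsHomogeneous 1) ∧ LinearIndependent k η ∧
      eval v (η 0) = 0 ∧ eval v (η 2) = 0 ∧ c = η 1 * η 2 - η 0 ^ 2 := by
  obtain ⟨B, hsymm, hev, hnd⟩ := hc.exists_bilin h2
  have hvv : B v v = 0 := by rw [← hev, hvc]
  obtain ⟨u, huu, hvu⟩ : ∃ u, B u u = 0 ∧ B v u = 1 / 2 := by
    obtain ⟨w, hw⟩ := hnd v hv
    let u₀ := (1 / (2 * B v w)) • w
    have h0 : B v u₀ = 1 / 2 := by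
      simp only [u₀, map_smul, smul_eq_mul]
      field_simp
    -- A translation along the isotropic `v` keeps the pairing with `v` and cancels `B u₀ u₀`, as `2
    -- * B v u₀ = 1`.
    refine ⟨u₀ - B u₀ u₀ • v, ?_, ?_⟩
    · simp only [map_sub, map_smul, LinearMap.sub_apply, LinearMap.smul_apply, smul_eq_mul,
        hsymm u₀ v, h0, hvv]
      field_simp
      ring
    · simp [h0, hvv]
  have huv : B u v = 1 / 2 := by rw [hsymm, hvu]
  obtain ⟨n, hnu, hnv, hnn⟩ : ∃ n, B u n = 0 ∧ B v n = 0 ∧ B n n = -1 := by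
    have hker : LinearMap.ker ((B u).prod (B v)) ≠ ⊥ :=
      LinearMap.ker_ne_bot_of_finrank_lt (by simp)
    obtain ⟨n, hn, hn0⟩ := Submodule.exists_mem_ne_zero_of_ne_bot hker
    replace hn : B u n = 0 ∧ B v n = 0 := ⟨congrArg Prod.fst hn, congrArg Prod.snd hn⟩
    -- Otherwise `n` is orthogonal to the basis `v`, `u`, `n`, against nondegeneracy.
    have hnn : B n n ≠ 0 := by
      intro hnn
      obtain ⟨w, hw⟩ := hnd n hn0
      have hli : LinearIndependent k ![v, u, n] := by
        rw [Fintype.linearIndependent_iff]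
        intro g hg
        simp only [Fin.sum_univ_three, Matrix.cons_val] at hg
        have e1 := congrArg (B v) hg
        have e2 := congrArg (B u) hg
        simp only [map_add, map_smul, smul_eq_mul, hvv, hvu, hn.1, hn.2, huu, huv, map_zero,
          mul_zero, zero_add, add_zero] at e1 e2
        have g1 : g 1 = 0 := by simpa [h2] using e1
        have g0 : g 0 = 0 := by simpa [h2] using e2
        rw [g0, g1] at hg
        have g2 : g 2 = 0 := by simpa [hn0] using hg
        intro i
        fin_cases i <;> assumption
      have htop := hli.span_eq_top_of_card_eq_finrank' (by simp)
      have hw' : w ∈ Submodule.span k (Set.range ![v, u, n]) := htop ▸ Submodule.mem_top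
      apply hw
      refine Submodule.span_induction (p := fun x _ => B n x = 0) ?_ (by simp)
        (fun x y _ _ hx hy => by rw [map_add, hx, hy, add_zero])
        (fun a x _ hx => by rw [map_smul, hx, smul_zero]) hw'
      rintro _ ⟨i, rfl⟩
      fin_cases i
      · exact (hsymm n v).trans hn.2
      · exact (hsymm n u).trans hn.1
      · exact hnn
    obtain ⟨δ, hδ⟩ := IsAlgClosed.exists_pow_nat_eq (-B n n) zero_lt_two
    have hδ0 : δ ≠ 0 := by
      rintro rfl
      apply hnn
      simpa using hδ.symm
    refine ⟨δ⁻¹ • n, by simp [hn.1], by simp [hn.2], ?_⟩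
    have : B n n = -δ ^ 2 := by rw [hδ, neg_neg]
    simp only [map_smul, LinearMap.smul_apply, smul_eq_mul, this]
    field_simp
  have hun := (hsymm n u).trans hnu
  have hvn := (hsymm n v).trans hnv
  have hli : LinearIndependent k ![v, u, n] := by
    rw [Fintype.linearIndependent_iff]
    intro g hg
    simp only [Fin.sum_univ_three, Matrix.cons_val] at hg
    have e1 := congrArg (B v) hg
    have e2 := congrArg (B u) hg
    have e3 := congrArg (B n) hg
    simp only [map_add, map_smul, smul_eq_mul, hvv, hvu, hnu, hnv, huu, huv, hnn, hun, hvn,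
      map_zero, mul_zero, zero_add, add_zero] at e1 e2 e3
    have g1 : g 1 = 0 := by simpa [h2] using e1
    have g0 : g 0 = 0 := by simpa [h2] using e2
    have g2 : g 2 = 0 := by simpa using e3
    intro i
    fin_cases i <;> assumption
  have htop := hli.span_eq_top_of_card_eq_finrank' (by simp)
  choose! lin hlin hlin' using exists_isHomogeneous_one_eval_eq (k := k) (n := 3)
  refine ⟨![lin (-B n), lin ((2 : k) • B u), lin ((2 : k) • B v)], ?_, ?_, ?_, ?_, ?_⟩
  · intro i
    fin_cases i <;> exact hlin _
  · refine linearIndependent_of_forall_exists_eval fun i => ?_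
    refine ⟨![n, v, u] i, ?_, ?_⟩
    · fin_cases i <;> simp [hlin', hnn, huv, hvu, h2]
    · intro j hj
      fin_cases i <;> fin_cases j <;> first | exact absurd rfl hj | simp [hlin', hvn, hun, hnu, hnv, huu, hvv]
  · simp [hlin', hvn]
  · simp [hlin', hvv]
  · have : Infinite k := IsAlgClosed.instInfinite
    refine MvPolynomial.funext fun x => ?_
    have hx : x ∈ Submodule.span k (Set.range ![v, u, n]) := htop ▸ Submodule.mem_top
    obtain ⟨g, rfl⟩ := (Submodule.mem_span_range_iff_exists_fun k).1 hx
    simp only [Fin.sum_univ_three, Matrix.cons_val, map_sub, map_mul, map_pow, hlin', hev,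
      map_add, map_smul, LinearMap.add_apply, LinearMap.smul_apply, LinearMap.neg_apply,
      smul_eq_mul, hvv, hvu, hnu, hnv, huu, huv, hnn, hun, hvn]
    field_simp
    ring

theorem exists_ne_zero_eval_eq_zero [IsAlgClosed k] (h2 : (2 : k) ≠ 0)
    {c : MvPolynomial (Fin 3) k} (hc : c.IsHomogeneous 2) : ∃ v, v ≠ 0 ∧ eval v c = 0 := by
  obtain ⟨a, hsymm, rfl⟩ := exists_eq_sum_C_mul_X_mul_X h2 hc
  by_cases h0 : a 0 0 = 0
  · exact ⟨![1, 0, 0], by simp, by simp [Fin.sum_univ_three, h0]⟩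
  · obtain ⟨δ, hδ⟩ := IsAlgClosed.exists_pow_nat_eq (a 0 1 ^ 2 - a 0 0 * a 1 1) zero_lt_two
    -- A point on the line `X₂ = 0`, by the quadratic formula.
    refine ⟨![(-a 0 1 + δ) / a 0 0, 1, 0], by simp, ?_⟩
    simp only [Fin.sum_univ_three, map_add, map_mul, eval_C, eval_X, Matrix.cons_val, hsymm 1 0]
    field_simp
    linear_combination hδ

theorem isCoords_cons {n : ℕ} {ξ : Fin n → MvPolynomial (Fin (n + 1)) k}
    (hξ : ∀ i, (ξ i).IsHomogeneous 1) (hli : LinearIndependent k ξ) {p : Fin (n + 1) → k}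
    (hp : ∀ i, eval p (ξ i) = 0) {x : MvPolynomial (Fin (n + 1)) k} (hx : x.IsHomogeneous 1)
    (hxp : eval p x ≠ 0) : IsCoords (Fin.cons x ξ : Fin (n + 1) → MvPolynomial (Fin (n + 1)) k) := by
  refine ⟨fun i => Fin.cases hx hξ i, ?_⟩
  rw [linearIndependent_finCons]
  refine ⟨hli, fun h => hxp ?_⟩
  refine Submodule.span_induction (p := fun x _ => eval p x = 0) ?_ (by simp)
    (fun x y _ _ hx hy => by rw [map_add, hx, hy, add_zero])
    (fun a x _ hx => by rw [smul_eval, hx, mul_zero]) h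
  rintro _ ⟨i, rfl⟩
  exact hp i

/-- A variable that is nonzero at `p` completes `ξ` to coordinates; in these, `u` minus a suitable
multiple of `p` is zero. -/
theorem exists_eq_smul_of_eval_eq_zero {n : ℕ} {ξ : Fin n → MvPolynomial (Fin (n + 1)) k}
    (hξ : ∀ i, (ξ i).IsHomogeneous 1) (hli : LinearIndependent k ξ) {p : Fin (n + 1) → k}
    (hp0 : p ≠ 0) (hp : ∀ i, eval p (ξ i) = 0) {u : Fin (n + 1) → k}
    (hu : ∀ i, eval u (ξ i) = 0) : ∃ c : k, u = c • p := by
  obtain ⟨i, hi⟩ := Function.ne_iff.1 hp0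
  have hi : p i ≠ 0 := hi
  have h := isCoords_cons hξ hli hp (isHomogeneous_X k i) (by simpa using hi)
  refine ⟨u i / p i, ?_⟩
  rw [← sub_eq_zero, sub_eq_add_neg, ← neg_smul]
  apply h.eq_zero
  refine Fin.cases ?_ fun j => ?_
  · simp [hi]
  · rw [Fin.cons_succ, eval_add_of_isHomogeneous_one (hξ j),
      eval_smul_of_isHomogeneous_one (hξ j), hu, hp, mul_zero, add_zero]

/-- Pulls the normal form of the base conic back along the projection. The last clause says that `ξ₀
= ξ₂ = 0` on the ruling over `v`; it makes the form adaptable to a chosen ruling. -/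
theorem ClosedSubscheme.IsConicCone.exists_normalForm_aux [IsAlgClosed k] (h2 : (2 : k) ≠ 0)
    {p : ℙ k (Fin 4 → k)} {l : Fin 3 → CoordRing k} {c : MvPolynomial (Fin 3) k}
    (hl : ∀ i, (l i).IsHomogeneous 1) (hli : LinearIndependent k l)
    (hlp : ∀ i, eval p.rep (l i) = 0) (hc : IsSmoothPlaneConic c) {v : Fin 3 → k} (hv : v ≠ 0)
    (hvc : eval v c = 0) :
    ∃ ξ : Fin 3 → CoordRing k, (∀ i, (ξ i).IsHomogeneous 1) ∧ LinearIndependent k ξ ∧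
      (∀ i, eval p.rep (ξ i) = 0) ∧ aeval l c = ξ 1 * ξ 2 - ξ 0 ^ 2 ∧
      ∀ u : Fin 4 → k, (∀ i, eval u (l i) = v i) → eval u (ξ 0) = 0 ∧ eval u (ξ 2) = 0 := by
  obtain ⟨η, hη, hηli, hη0, hη2, rfl⟩ := hc.exists_eq h2 hv hvc
  have hev : ∀ (u : Fin 4 → k) (q : MvPolynomial (Fin 3) k),
      eval u (aeval l q) = eval (fun i => eval u (l i)) q := by
    intro u q
    have : (aeval u : CoordRing k →ₐ[k] k).comp (aeval l) = aeval fun i => eval u (l i) := by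
      ext1 i
      simp [aeval_eq_eval]
    simpa [aeval_eq_eval] using DFunLike.congr_fun this q
  refine ⟨fun i => aeval l (η i), fun i => ?_, ?_, fun i => ?_, by simp, fun u hu => ?_⟩
  · simpa using (hη i).aeval l hl
  · refine linearIndependent_of_forall_exists_eval fun i => ?_
    obtain ⟨t, ht⟩ := exists_forall_eval_eq hη hηli (Pi.single i 1)
    obtain ⟨u, hu⟩ := exists_forall_eval_eq hl hli t
    refine ⟨u, ?_, fun j hj => ?_⟩ <;> rw [hev, funext hu, ht]
    · simp
    · simp [hj]
  · rw [hev, funext hlp]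
    obtain ⟨a, ha⟩ := exists_eq_sum_C_mul_X (hη i)
    simp [ha]
  · rw [hev, hev, funext hu]
    exact ⟨hη0, hη2⟩

/-- In suitable linear coordinates, a conic cone has the equation `y z = w²`. -/
theorem ClosedSubscheme.IsConicCone.exists_normalForm [IsAlgClosed k] (h2 : (2 : k) ≠ 0)
    {Z : ClosedSubscheme k} {p : ℙ k (Fin 4 → k)} (hZ : Z.IsConicCone p) :
    ∃ ξ : Fin 3 → CoordRing k, (∀ i, (ξ i).IsHomogeneous 1) ∧ LinearIndependent k ξ ∧
      (∀ i, eval p.rep (ξ i) = 0) ∧ Z.IsCutOutBy {ξ 1 * ξ 2 - ξ 0 ^ 2} := by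
  obtain ⟨l, c, hl, hli, hlp, hc, hZc⟩ := hZ
  obtain ⟨v, hv, hvc⟩ := exists_ne_zero_eval_eq_zero h2 hc.1
  obtain ⟨ξ, h1, h3, h4, h5, -⟩ := exists_normalForm_aux h2 hl hli hlp hc hv hvc
  exact ⟨ξ, h1, h3, h4, h5 ▸ hZc⟩

/-- The coordinates of the normal form can be adapted to a point of the cone. -/
theorem ClosedSubscheme.IsConicCone.exists_normalForm_of_eval [IsAlgClosed k] (h2 : (2 : k) ≠ 0)
    {Z : ClosedSubscheme k} {p : ℙ k (Fin 4 → k)} (hZ : Z.IsConicCone p) {u : Fin 4 → k}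
    (hu : ∀ f ∈ Z.ideal, eval u f = 0) (hup : ∀ c : k, u ≠ c • p.rep) :
    ∃ ξ : Fin 3 → CoordRing k, (∀ i, (ξ i).IsHomogeneous 1) ∧ LinearIndependent k ξ ∧
      (∀ i, eval p.rep (ξ i) = 0) ∧ Z.IsCutOutBy {ξ 1 * ξ 2 - ξ 0 ^ 2} ∧
      eval u (ξ 0) = 0 ∧ eval u (ξ 2) = 0 := by
  obtain ⟨l, c, hl, hli, hlp, hc, hZc⟩ := hZ
  have hv : (fun i => eval u (l i)) ≠ 0 := by
    intro h
    obtain ⟨a, ha⟩ := exists_eq_smul_of_eval_eq_zero hl hli p.rep_nonzero hlp (congrFun h)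
    exact hup a ha
  have hmem : aeval l c ∈ Z.ideal := by
    rw [hZc]
    exact le_saturation _ (Ideal.subset_span rfl)
  have hvc : eval (fun i => eval u (l i)) c = 0 := by
    have h0 := hu _ hmem
    have : (aeval u : CoordRing k →ₐ[k] k).comp (aeval l) = aeval fun i => eval u (l i) := by
      ext1 i
      simp [aeval_eq_eval]
    have := DFunLike.congr_fun this c
    simp only [AlgHom.comp_apply, aeval_eq_eval] at this
    rw [← this]
    exact h0
  obtain ⟨ξ, h1, h3, h4, h5, h6⟩ := exists_normalForm_aux h2 hl hli hlp hc hv hvc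
  exact ⟨ξ, h1, h3, h4, h5 ▸ hZc, h6 u fun _ => rfl⟩

end NormalForm

/-! ### Ideals under coordinate changes, square roots of forms, directional derivatives -/

section Auxiliary

theorem mem_map_algEquiv {A : Type*} [CommRing A] [Algebra k A] (E : A ≃ₐ[k] A) (I : Ideal A)
    (x : A) : x ∈ I.map E ↔ E.symm x ∈ I := by
  change x ∈ I.map (E : A ≃+* A) ↔ _
  rw [← Ideal.comap_symm]
  rfl

theorem map_inf_algEquiv {A : Type*} [CommRing A] [Algebra k A] (E : A ≃ₐ[k] A) (I J : Ideal A) :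
    (I ⊓ J).map E = I.map E ⊓ J.map E := by
  ext x
  simp only [mem_map_algEquiv, Ideal.mem_inf]

theorem map_isPrime_algEquiv {A : Type*} [CommRing A] [Algebra k A] (E : A ≃ₐ[k] A) {I : Ideal A}
    (hI : I.IsPrime) : (I.map E).IsPrime := by
  change (I.map (E : A ≃+* A)).IsPrime
  rw [← Ideal.comap_symm]
  exact Ideal.comap_isPrime _ _

theorem span_pair_C_mul {n : ℕ} {a b : k} (ha : a ≠ 0) (hb : b ≠ 0) (f g : MvPolynomial (Fin n) k) :
    Ideal.span {C a * f, C b * g} = Ideal.span {f, g} := by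
  have h : ∀ {a b : k} (f g : MvPolynomial (Fin n) k),
      Ideal.span {C a * f, C b * g} ≤ Ideal.span {f, g} := by
    intro a b f g
    rw [Ideal.span_le]
    rintro _ (rfl | rfl)
    · exact Ideal.mul_mem_left _ _ (Ideal.subset_span (by simp))
    · exact Ideal.mul_mem_left _ _ (Ideal.subset_span (by simp))
  refine le_antisymm (h f g) ?_
  have := h (a := a⁻¹) (b := b⁻¹) (C a * f) (C b * g)
  rwa [← mul_assoc, ← mul_assoc, ← C_mul, ← C_mul, inv_mul_cancel₀ ha, inv_mul_cancel₀ hb, C_1,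
    one_mul, one_mul] at this

/-- A nonzero `c` has total degree 2. In degree 0 the square is `c₀²`, so `c₀ = 0`; then in degree 2
it is `c₁²`, so `c₁ = 0`. -/
theorem isHomogeneous_of_sq {σ : Type*} {c : MvPolynomial σ k}
    (hc : (c ^ 2).IsHomogeneous 4) : c.IsHomogeneous 2 := by
  by_cases h0 : c = 0
  · rw [h0]; exact isHomogeneous_zero _ _ _
  have hdeg : c.totalDegree = 2 := by
    have h1 := hc.totalDegree (pow_ne_zero 2 h0)
    rw [sq, totalDegree_mul_of_isDomain h0 h0] at h1
    omega
  have hsum := sum_homogeneousComponent c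
  rw [hdeg] at hsum
  simp only [Finset.sum_range_succ, Finset.sum_range_zero, zero_add] at hsum
  have H : ∀ i, (homogeneousComponent i c).IsHomogeneous i :=
    fun i => homogeneousComponent_isHomogeneous i c
  set c0 := homogeneousComponent 0 c
  set c1 := homogeneousComponent 1 c
  set c2 := homogeneousComponent 2 c
  have e : c ^ 2 = c0 * c0 + (c0 * c1 + c0 * c1) + (c0 * c2 + c0 * c2 + c1 * c1) +
      (c1 * c2 + c1 * c2) + c2 * c2 := by rw [← hsum]; ring
  have comp : ∀ (m i j : ℕ), homogeneousComponent m
      (homogeneousComponent i c * homogeneousComponent j c) =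
      if m = i + j then homogeneousComponent i c * homogeneousComponent j c else 0 :=
    fun m i j => homogeneousComponent_of_mem ((H i).mul (H j))
  have e0 := congrArg (homogeneousComponent 0) e
  have hz : c0 = 0 := by
    rw [homogeneousComponent_of_mem hc] at e0
    simpa [c0, c1, c2, comp, -homogeneousComponent_zero] using e0
  have e2 := congrArg (homogeneousComponent 2) e
  have ho : c1 = 0 := by
    rw [homogeneousComponent_of_mem hc, hz] at e2
    simpa [c1, c2, comp, -homogeneousComponent_zero] using e2
  rw [← hsum, hz, ho, zero_add, zero_add]
  exact H 2

/-- The derivative of `p` at `v` in the direction of `u`. -/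
noncomputable def dirDeriv {n : ℕ} (v u : Fin n → k) (p : MvPolynomial (Fin n) k) : k :=
  ∑ i, u i * eval v (pderiv i p)

theorem dirDeriv_mul {n : ℕ} (v u : Fin n → k) (p q : MvPolynomial (Fin n) k) :
    dirDeriv v u (p * q) = eval v p * dirDeriv v u q + eval v q * dirDeriv v u p := by
  simp only [dirDeriv, Derivation.leibniz, smul_eq_mul, map_add, map_mul, Finset.mul_sum,
    ← Finset.sum_add_distrib]
  exact Finset.sum_congr rfl fun i _ => by ring

theorem dirDeriv_sub {n : ℕ} (v u : Fin n → k) (p q : MvPolynomial (Fin n) k) :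
    dirDeriv v u (p - q) = dirDeriv v u p - dirDeriv v u q := by
  simp [dirDeriv, mul_sub, Finset.sum_sub_distrib]

theorem dirDeriv_of_isHomogeneous_one {n : ℕ} (v u : Fin n → k) {p : MvPolynomial (Fin n) k}
    (hp : p.IsHomogeneous 1) : dirDeriv v u p = eval u p := by
  obtain ⟨a, rfl⟩ := exists_eq_sum_C_mul_X hp
  simp [dirDeriv, Derivation.leibniz, pderiv_X, Pi.single_apply, mul_comm]

theorem linearIndependent_of_dirDeriv {n : ℕ} {v : Fin n → k} {l q : MvPolynomial (Fin n) k}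
    (h : ∀ a b : k, (∀ u, a * dirDeriv v u l + b * dirDeriv v u q = 0) → a = 0 ∧ b = 0) :
    LinearIndependent k ![fun i => eval v (pderiv i l), fun i => eval v (pderiv i q)] := by
  rw [LinearIndependent.pair_iff]
  refine fun a b hab => h a b fun u => ?_
  have := fun i => congrFun hab i
  simp only [Pi.add_apply, Pi.smul_apply, smul_eq_mul, Pi.zero_apply] at this
  simp only [dirDeriv, Finset.mul_sum, ← Finset.sum_add_distrib]
  exact Finset.sum_eq_zero fun i _ => by linear_combination u i * this i

theorem eval_zero_of_isHomogeneous {n m : ℕ} {p : MvPolynomial (Fin n) k}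
    (hp : p.IsHomogeneous (m + 1)) : eval 0 p = 0 := by
  rw [eval_zero, constantCoeff_eq]
  exact hp.coeff_eq_zero (by simp)

theorem exists_eval_eq_of_isCoords {n : ℕ} {ξ : Fin n → MvPolynomial (Fin n) k} (h : IsCoords ξ)
    {u : Fin n → k} (hu : u ≠ 0) : ∃ v, v ≠ 0 ∧ ∀ i, eval v (ξ i) = u i := by
  obtain ⟨v, hv⟩ := exists_forall_eval_eq h.1 h.2 u
  refine ⟨v, ?_, hv⟩
  rintro rfl
  exact hu (funext fun i => by rw [← hv i, eval_zero_of_isHomogeneous (h.1 i), Pi.zero_apply])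

theorem IsCoords.exists_eq_sum_sum (h2 : (2 : k) ≠ 0) {n : ℕ} {ξ : Fin n → MvPolynomial (Fin n) k}
    (h : IsCoords ξ) {p : MvPolynomial (Fin n) k} (hp : p.IsHomogeneous 2) :
    ∃ a : Fin n → Fin n → k, (∀ i j, a i j = a j i) ∧ p = ∑ i, ∑ j, C (a i j) * ξ i * ξ j := by
  obtain ⟨E, hE, hE'⟩ := h.exists_algEquiv
  have h1 : (E.symm p).IsHomogeneous 2 := by
    have : E.symm p = aeval (fun i => E.symm (X i)) p := by
      have : (E.symm : MvPolynomial (Fin n) k →ₐ[k] MvPolynomial (Fin n) k) =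
          aeval (fun i => E.symm (X i)) := by
        ext1 i
        simp
      exact DFunLike.congr_fun this p
    rw [this]
    simpa using hp.aeval _ hE'
  obtain ⟨a, ha, ha'⟩ := exists_eq_sum_C_mul_X_mul_X h2 h1
  refine ⟨a, ha, ?_⟩
  have := congrArg E ha'
  simpa only [AlgEquiv.apply_symm_apply, map_sum, map_mul, hE, ← algebraMap_eq,
    AlgEquiv.commutes] using this

theorem exists_ne_zero_forall_eval_eq_zero {m n : ℕ} (hmn : m < n)
    {η : Fin m → MvPolynomial (Fin n) k} (hη : ∀ i, (η i).IsHomogeneous 1) :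
    ∃ v, v ≠ 0 ∧ ∀ i, eval v (η i) = 0 := by
  choose a ha using fun i => exists_eq_sum_C_mul_X (hη i)
  have hker : LinearMap.ker (Matrix.of a).mulVecLin ≠ ⊥ :=
    LinearMap.ker_ne_bot_of_finrank_lt (by simpa using hmn)
  obtain ⟨v, hv, hv0⟩ := Submodule.exists_mem_ne_zero_of_ne_bot hker
  refine ⟨v, hv0, fun i => ?_⟩
  have := congrFun hv i
  rw [ha i]
  simpa [Matrix.mulVec, dotProduct] using this

end Auxiliary

/-! ### Nondegenerate subschemes -/

section Nondegenerate

/-- `Z` is not contained set-theoretically in any plane. -/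
def ClosedSubscheme.IsNondegenerate (Z : ClosedSubscheme k) : Prop :=
  ∀ l : CoordRing k, l.IsHomogeneous 1 → l ∈ Z.ideal.radical → l = 0

theorem ClosedSubscheme.eval_eq_zero_of_mem_radical {Z : ClosedSubscheme k} {f g : CoordRing k}
    (hZ : Z.IsCutOutBy {f, g}) {v : Fin 4 → k} (hv : v ≠ 0) (hf : eval v f = 0)
    (hg : eval v g = 0) {l : CoordRing k} (hl : l ∈ Z.ideal.radical) : eval v l = 0 := by
  obtain ⟨n, hn⟩ := hl
  rw [hZ] at hn
  have := eval_eq_zero_of_mem_saturation_span hv (by rintro _ (rfl | rfl) <;> assumption) hn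
  rw [map_pow] at this
  exact eq_zero_of_pow_eq_zero this

/-- Nondegeneracy from common zeros of `f` and `g`, given in linear coordinates. -/
theorem ClosedSubscheme.isNondegenerate_of_eval {Z : ClosedSubscheme k} {f g : CoordRing k}
    {Ξ : Fin 4 → CoordRing k} (hΞ : IsCoords Ξ) (hZ : Z.IsCutOutBy {f, g})
    (h : ∀ a : Fin 4 → k, (∀ u : Fin 4 → k, u ≠ 0 → (∀ v, (∀ i, eval v (Ξ i) = u i) →
      eval v f = 0 ∧ eval v g = 0) → ∑ i, a i * u i = 0) → ∀ i, a i = 0) :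
    Z.IsNondegenerate := by
  intro l hl hlZ
  obtain ⟨a, rfl⟩ := hΞ.exists_eq_sum hl
  have ha := h a fun u hu huv => by
    obtain ⟨v, hv, hvu⟩ := exists_eval_eq_of_isCoords hΞ hu
    have := eval_eq_zero_of_mem_radical hZ hv (huv v hvu).1 (huv v hvu).2 hlZ
    simpa [hvu] using this
  simp [ha]

end Nondegenerate

/-! ### Component curves and decompositions of ideals -/

section Curves

variable {E : CoordRing k ≃ₐ[k] CoordRing k}

theorem map_span_pair (E : CoordRing k ≃ₐ[k] CoordRing k) (f g : CoordRing k) :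
    (Ideal.span {f, g}).map E = Ideal.span {E f, E g} := by
  rw [Ideal.map_span, Set.image_pair]

theorem isHomogeneous_algEquiv (hE : IsCoords fun i => E (X i)) {p : CoordRing k} {n : ℕ}
    (hp : p.IsHomogeneous n) : (E p).IsHomogeneous n := by
  have : (E : CoordRing k →ₐ[k] CoordRing k) = aeval fun i => E (X i) := by
    ext1 i
    simp
  rw [show E p = aeval (fun i => E (X i)) p from DFunLike.congr_fun this p]
  simpa using hp.aeval _ hE.1

theorem eval_algEquiv (E : CoordRing k ≃ₐ[k] CoordRing k) (v : Fin 4 → k) (p : CoordRing k) :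
    eval v (E p) = eval (fun i => eval v (E (X i))) p := by
  have : (aeval v : CoordRing k →ₐ[k] k).comp (E : CoordRing k →ₐ[k] CoordRing k) =
      aeval fun i => eval v (E (X i)) := by
    ext1 i
    simp [aeval_eq_eval]
  simpa [aeval_eq_eval] using DFunLike.congr_fun this p

theorem eval_cons_rename {v : Fin 4 → k} (q : MvPolynomial (Fin 3) k) :
    eval v (rename Fin.succ q) = eval (Fin.tail v) q := by
  rw [eval_rename]
  rfl

theorem isPrime_conic (r : MvPolynomial (Fin 3) k) :
    (Ideal.span {X 0 - rename Fin.succ r, X 1 ^ 2 - X 2 * X 3} : Ideal (CoordRing k)).IsPrime := by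
  rw [← ker_conicParam_comp]
  exact RingHom.ker_isPrime _

theorem mem_conic_iff {r : MvPolynomial (Fin 3) k} {p : CoordRing k} :
    p ∈ (Ideal.span {X 0 - rename Fin.succ r, X 1 ^ 2 - X 2 * X 3} : Ideal (CoordRing k)) ↔
      conicParam k (aeval (Fin.cons r X : Fin 4 → MvPolynomial (Fin 3) k) p) = 0 := by
  rw [← ker_conicParam_comp]
  rfl

theorem isHomogeneous_conic_quadric : (X 1 ^ 2 - X 2 * X 3 : CoordRing k).IsHomogeneous 2 :=
  ((isHomogeneous_X k 1).pow 2).sub ((isHomogeneous_X k 2).mul (isHomogeneous_X k 3))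

/-- The ideal is prime and omits `E (X 1)`, hence is saturated. For the Jacobian criterion, a
relation between the gradients is tested along the four coordinate directions. -/
theorem exists_isSmoothConic (h2 : (2 : k) ≠ 0) (hE : IsCoords fun i => E (X i))
    {r : MvPolynomial (Fin 3) k} (hr : r.IsHomogeneous 1) :
    ∃ C : ClosedSubscheme k, C.IsSmoothConic ∧
      C.ideal = (Ideal.span {X 0 - rename Fin.succ r, X 1 ^ 2 - X 2 * X 3}).map E := by
  have hl : (X 0 - rename Fin.succ r : CoordRing k).IsHomogeneous 1 :=
    (isHomogeneous_X k 0).sub hr.rename_isHomogeneous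
  have hl' := isHomogeneous_algEquiv hE hl
  have hq' := isHomogeneous_algEquiv hE isHomogeneous_conic_quadric
  have hsat : saturation ((Ideal.span {X 0 - rename Fin.succ r, X 1 ^ 2 - X 2 * X 3}).map E) =
      (Ideal.span {X 0 - rename Fin.succ r, X 1 ^ 2 - X 2 * X 3}).map E := by
    refine saturation_eq_self_of_isPrime (map_isPrime_algEquiv E (isPrime_conic r)) (hE.1 1) ?_
    rw [mem_map_algEquiv, AlgEquiv.symm_apply_apply, mem_conic_iff, aeval_X,
      show (1 : Fin 4) = Fin.succ 0 from rfl, Fin.cons_succ]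
    simp [conicParam]
  refine ⟨ClosedSubscheme.cutOut {E (X 0 - rename Fin.succ r), E (X 1 ^ 2 - X 2 * X 3)} ?_,
    ⟨_, _, hl', hq', rfl, ?_⟩, ?_⟩
  · rintro _ (rfl | rfl)
    exacts [⟨1, hl'⟩, ⟨2, hq'⟩]
  · intro v hv hvl hvq
    refine linearIndependent_of_dirDeriv fun a b hab => ?_
    have hq : ∀ u, dirDeriv v u (E (X 1 ^ 2 - X 2 * X 3)) =
        2 * eval v (E (X 1)) * eval u (E (X 1)) - eval v (E (X 2)) * eval u (E (X 3)) -
          eval v (E (X 3)) * eval u (E (X 2)) := by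
      intro u
      simp only [map_sub, map_mul, dirDeriv_sub, sq, dirDeriv_mul]
      simp only [dirDeriv_of_isHomogeneous_one v u (hE.1 _)]
      ring
    have hlu : ∀ u, dirDeriv v u (E (X 0 - rename Fin.succ r)) =
        eval u (E (X 0)) - eval (fun i => eval u (E (X (Fin.succ i)))) r := by
      intro u
      rw [dirDeriv_of_isHomogeneous_one v u hl', eval_algEquiv, map_sub, eval_X, eval_cons_rename]
      rfl
    simp only [hq, hlu] at hab
    -- The quadric does not involve the coordinate 0, so this direction sees only the linear form.
    have ha : a = 0 := by
      obtain ⟨u, hu⟩ := exists_forall_eval_eq hE.1 hE.2 ![1, 0, 0, 0]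
      have := hab u
      have h0 : eval (fun i : Fin 3 => (![1, 0, 0, 0] : Fin 4 → k) i.succ) r = 0 := by
        convert eval_zero_of_isHomogeneous (m := 0) hr with i
        fin_cases i <;> rfl
      simp only [hu, h0] at this
      simpa using this
    refine ⟨ha, ?_⟩
    by_contra hb
    subst ha
    apply hv
    have h1 : eval v (E (X 1)) = 0 := by
      obtain ⟨u, hu⟩ := exists_forall_eval_eq hE.1 hE.2 ![0, 1, 0, 0]
      have := hab u
      simp only [hu] at this
      simpa [hb, h2] using this
    have h3 : eval v (E (X 3)) = 0 := by
      obtain ⟨u, hu⟩ := exists_forall_eval_eq hE.1 hE.2 ![0, 0, 1, 0]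
      have := hab u
      simp only [hu] at this
      simpa [hb] using this
    have h4 : eval v (E (X 2)) = 0 := by
      obtain ⟨u, hu⟩ := exists_forall_eval_eq hE.1 hE.2 ![0, 0, 0, 1]
      have := hab u
      simp only [hu] at this
      simpa [hb] using this
    refine hE.eq_zero fun i => ?_
    rw [eval_algEquiv, map_sub, eval_X, eval_cons_rename] at hvl
    have ht : (Fin.tail fun i => eval v (E (X i))) = 0 := by
      ext i
      fin_cases i
      exacts [h1, h4, h3]
    rw [ht, eval_zero_of_isHomogeneous (m := 0) hr, sub_zero] at hvl
    fin_cases i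
    exacts [hvl, h1, h4, h3]
  · change saturation _ = _
    rw [← map_span_pair, hsat]

/-- The list of possible intersections of two conic cones with distinct vertices. -/
def ClosedSubscheme.IsConeIntersection (Z : ClosedSubscheme k) : Prop :=
  Z.IsIrreducibleCurveOfDegree 4 ∨
    (∃ C L : ClosedSubscheme k, C.IsTwistedCubic ∧ L.IsLine ∧ Z = C.union L) ∨
    (∃ C D : ClosedSubscheme k, C.IsSmoothConic ∧ D.IsSmoothConic ∧ C ≠ D ∧ Z = C.union D) ∨
    (∃ C D : ClosedSubscheme k, C.IsSmoothConic ∧ D.IsDoubledLine ∧ Z = C.union D)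

/-- If `a (X₀ - r)` lies in the prime ideal of the second conic, so does `a`, because `X₀ - r`
restricts there to `-2r ≠ 0`. It remains to see that `(X₀ - r)(X₀ + r)` is `X₀² - q` up to a
multiple of `X₁² - X₂X₃`. -/
theorem conic_inf_conic (h2 : (2 : k) ≠ 0) {q r : MvPolynomial (Fin 3) k}
    (hr0 : conicParam k r ≠ 0) (hq : conicParam k q = conicParam k r ^ 2) :
    (Ideal.span {X 1 ^ 2 - X 2 * X 3, X 0 ^ 2 - rename Fin.succ q} : Ideal (CoordRing k)) =
      Ideal.span {X 0 - rename Fin.succ r, X 1 ^ 2 - X 2 * X 3} ⊓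
        Ideal.span {X 0 - rename Fin.succ (-r), X 1 ^ 2 - X 2 * X 3} := by
  have hcons : ∀ r p : MvPolynomial (Fin 3) k,
      aeval (Fin.cons r X : Fin 4 → MvPolynomial (Fin 3) k) (rename Fin.succ p) = p := by
    intro r p
    rw [aeval_rename]
    simp [Function.comp_def]
  have hqr : rename Fin.succ (q - r ^ 2) ∈
      (Ideal.span {X 1 ^ 2 - X 2 * X 3} : Ideal (CoordRing k)) := by
    have : q - r ^ 2 ∈ RingHom.ker (conicParam k) := by
      rw [RingHom.mem_ker, map_sub, map_pow, hq, sub_self]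
    rw [ker_conicParam, Ideal.mem_span_singleton] at this
    obtain ⟨c, hc⟩ := this
    rw [hc, map_mul]
    refine Ideal.mul_mem_right _ _ ?_
    convert Ideal.mem_span_singleton_self (X 1 ^ 2 - X 2 * X 3 : CoordRing k) using 1
    simp
  apply le_antisymm
  · refine Ideal.span_le.2 ?_
    rintro _ (rfl | rfl)
    · exact ⟨Ideal.subset_span (by simp), Ideal.subset_span (by simp)⟩
    · constructor <;> rw [SetLike.mem_coe, mem_conic_iff, map_sub, hcons] <;> simp [hq]
  · rintro p ⟨hp1, hp2⟩
    obtain ⟨a, b, rfl⟩ := Ideal.mem_span_pair.1 hp1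
    have hf : (X 1 ^ 2 - X 2 * X 3 : CoordRing k) ∈
        Ideal.span {X 1 ^ 2 - X 2 * X 3, X 0 ^ 2 - rename Fin.succ q} :=
      Ideal.subset_span (by simp)
    refine Ideal.add_mem _ ?_ (Ideal.mul_mem_left _ _ hf)
    have h3 : a * (X 0 - rename Fin.succ r) ∈
        Ideal.span {X 0 - rename Fin.succ (-r), X 1 ^ 2 - X 2 * X 3} := by
      have := Ideal.sub_mem _ hp2
        (Ideal.mul_mem_left (Ideal.span {X 0 - rename Fin.succ (-r), X 1 ^ 2 - X 2 * X 3}) b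
          (Ideal.subset_span (show (X 1 ^ 2 - X 2 * X 3 : CoordRing k) ∈ _ by simp)))
      simpa using this
    have h4 := ((isPrime_conic (-r)).mem_or_mem h3).resolve_right (by
      rw [mem_conic_iff, map_sub, hcons, aeval_X, Fin.cons_zero, map_sub, map_neg]
      intro h
      apply hr0
      have : C (2 : k) * conicParam k r = 0 := by
        rw [map_ofNat]
        linear_combination -h
      simpa [h2] using this)
    obtain ⟨c, d, rfl⟩ := Ideal.mem_span_pair.1 h4
    have h5 : rename Fin.succ (q - r ^ 2) ∈
        (Ideal.span {X 1 ^ 2 - X 2 * X 3, X 0 ^ 2 - rename Fin.succ q} : Ideal (CoordRing k)) :=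
      Ideal.span_mono (by simp) hqr
    have h6 : (X 0 ^ 2 - rename Fin.succ q : CoordRing k) ∈
        Ideal.span {X 1 ^ 2 - X 2 * X 3, X 0 ^ 2 - rename Fin.succ q} :=
      Ideal.subset_span (by simp)
    convert Ideal.add_mem _ (Ideal.mul_mem_left _ c (Ideal.add_mem _ h5 h6))
      (Ideal.mul_mem_left _ (d * (X 0 - rename Fin.succ r)) hf) using 1
    simp only [map_sub, map_pow, map_neg]
    ring

/-- An element `a X₃ + b X₁²` of the second ideal is `(a + b X₂) X₃` modulo `X₁² - X₂X₃`. As `X₃` is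
nonzero on the conic, `a + b X₂` vanishes there, and `(X₀ - X₂) X₃` is the difference of the two
generators on the left. -/
theorem conic_inf_doubledLine :
    (Ideal.span {X 1 ^ 2 - X 2 * X 3, X 1 ^ 2 - X 0 * X 3} : Ideal (CoordRing k)) =
      Ideal.span {X 0 - rename Fin.succ (X 1), X 1 ^ 2 - X 2 * X 3} ⊓
        Ideal.span {X 3, X 1 ^ 2} := by
  have hX : (rename Fin.succ (X 1 : MvPolynomial (Fin 3) k)) = X 2 := rename_X _ _
  set J : Ideal (CoordRing k) := Ideal.span {X 1 ^ 2 - X 2 * X 3, X 1 ^ 2 - X 0 * X 3} with hJ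
  have h1 : X 1 ^ 2 - X 2 * X 3 ∈ J := Ideal.subset_span (by simp)
  have h2 : X 1 ^ 2 - X 0 * X 3 ∈ J := Ideal.subset_span (by simp)
  apply le_antisymm
  · refine Ideal.span_le.2 ?_
    rintro _ (rfl | rfl)
    · refine ⟨Ideal.subset_span (by simp), Ideal.mem_span_pair.2 ⟨-X 2, 1, by ring⟩⟩
    · refine ⟨Ideal.mem_span_pair.2 ⟨-X 3, 1, by rw [hX]; ring⟩,
        Ideal.mem_span_pair.2 ⟨-X 0, 1, by ring⟩⟩
  · rintro p ⟨hp1, hp2⟩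
    obtain ⟨a, b, rfl⟩ := Ideal.mem_span_pair.1 hp2
    have h3 : (a + b * X 2) * X 3 ∈
        (Ideal.span {X 0 - rename Fin.succ (X 1), X 1 ^ 2 - X 2 * X 3} : Ideal (CoordRing k)) := by
      convert Ideal.sub_mem _ hp1 (Ideal.mul_mem_left _ b (Ideal.subset_span
        (show (X 1 ^ 2 - X 2 * X 3 : CoordRing k) ∈
          ({X 0 - rename Fin.succ (X 1), X 1 ^ 2 - X 2 * X 3} : Set _) by simp))) using 1
      ring
    have h4 := ((isPrime_conic _).mem_or_mem h3).resolve_right (by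
      rw [mem_conic_iff, aeval_X, show (3 : Fin 4) = Fin.succ 2 from rfl, Fin.cons_succ]
      simp [conicParam])
    obtain ⟨c, d, hcd⟩ := Ideal.mem_span_pair.1 h4
    rw [hX] at hcd
    convert J.add_mem (J.mul_mem_left b h1) (J.add_mem (J.mul_mem_left c (J.sub_mem h1 h2))
      (J.mul_mem_left (d * X 3) h1)) using 1
    linear_combination -X 3 * hcd

/-- Only multiples `c (X₀X₁ - X₂X₃)` of the third quadric are at issue. On the line this is `c
X₀X₁`, so `c` lies in `(X₂, X₃)`, and `X₂` and `X₃` each multiply the third quadric into the ideal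
of the first two. -/
theorem twistedCubic_inf_line :
    (Ideal.span {X 1 * X 2 - X 3 ^ 2, X 0 * X 3 - X 2 ^ 2} : Ideal (CoordRing k)) =
      Ideal.span {X 1 * X 2 - X 3 ^ 2, X 0 * X 3 - X 2 ^ 2, X 0 * X 1 - X 2 * X 3} ⊓
        Ideal.span {X 2, X 3} := by
  set J : Ideal (CoordRing k) := Ideal.span {X 1 * X 2 - X 3 ^ 2, X 0 * X 3 - X 2 ^ 2} with hJ
  have h1 : X 1 * X 2 - X 3 ^ 2 ∈ J := Ideal.subset_span (by simp)
  have h2 : X 0 * X 3 - X 2 ^ 2 ∈ J := Ideal.subset_span (by simp)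
  have hle : J ≤ Ideal.span {X 2, X 3} := by
    refine Ideal.span_le.2 ?_
    rintro _ (rfl | rfl)
    · exact Ideal.mem_span_pair.2 ⟨X 1, -X 3, by ring⟩
    · exact Ideal.mem_span_pair.2 ⟨-X 2, X 0, by ring⟩
  apply le_antisymm
  · refine le_inf (Ideal.span_mono ?_) hle
    rintro _ (rfl | rfl) <;> simp
  · rintro p ⟨hp1, hp2⟩
    obtain ⟨a, b, c, rfl⟩ : ∃ a b c, p = a * (X 1 * X 2 - X 3 ^ 2) + b * (X 0 * X 3 - X 2 ^ 2) +
        c * (X 0 * X 1 - X 2 * X 3) := by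
      obtain ⟨a, y, hy, rfl⟩ := Ideal.mem_span_insert.1 hp1
      obtain ⟨b, c, rfl⟩ := Ideal.mem_span_pair.1 hy
      exact ⟨a, b, c, by ring⟩
    have h3 : a * (X 1 * X 2 - X 3 ^ 2) + b * (X 0 * X 3 - X 2 ^ 2) ∈ J :=
      J.add_mem (J.mul_mem_left _ h1) (J.mul_mem_left _ h2)
    refine J.add_mem h3 ?_
    have h4 : c * (X 0 * X 1 - X 2 * X 3) ∈ (Ideal.span {X 2, X 3} : Ideal (CoordRing k)) := by
      simpa using Ideal.sub_mem _ hp2 (hle h3)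
    let π : CoordRing k →ₐ[k] MvPolynomial (Fin 2) k := aeval ![X 0, X 1, 0, 0]
    let ι : MvPolynomial (Fin 2) k →ₐ[k] CoordRing k := rename ![0, 1]
    have hsub : ∀ p : CoordRing k, p - ι (π p) ∈ (Ideal.span {X 2, X 3} : Ideal (CoordRing k)) := by
      intro p
      rw [← Ideal.Quotient.eq]
      have : Ideal.Quotient.mkₐ k (Ideal.span {X 2, X 3} : Ideal (CoordRing k)) =
          (Ideal.Quotient.mkₐ k _).comp (ι.comp π) := by
        ext1 i
        simp only [Ideal.Quotient.mkₐ_eq_mk, AlgHom.comp_apply]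
        rw [Ideal.Quotient.eq]
        fin_cases i
        · simp [π, ι]
        · simp [π, ι]
        · simpa [π, ι] using Ideal.subset_span (by simp)
        · simpa [π, ι] using Ideal.subset_span (by simp)
      exact DFunLike.congr_fun this p
    have hπ : π c = 0 := by
      have : (Ideal.span {X 2, X 3} : Ideal (CoordRing k)) ≤ RingHom.ker π := by
        refine Ideal.span_le.2 ?_
        rintro _ (rfl | rfl) <;> change _ = _ <;> simp [π]
      have := this h4
      rw [RingHom.mem_ker] at this
      simpa [π] using this
    have hc := hsub c
    rw [hπ, map_zero, sub_zero] at hc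
    obtain ⟨d, e, rfl⟩ := Ideal.mem_span_pair.1 hc
    convert J.add_mem (J.mul_mem_left d (J.add_mem (J.mul_mem_left (X 0) h1)
      (J.mul_mem_left (X 3) h2))) (J.mul_mem_left e (J.add_mem (J.mul_mem_left (X 1) h2)
      (J.mul_mem_left (X 2) h1))) using 1
    ring

end Curves

/-! ### The four types of intersection in adapted coordinates -/

section Cases

variable {E : CoordRing k ≃ₐ[k] CoordRing k}

namespace ClosedSubscheme

theorem prime_conic_quadric : Prime (X 1 ^ 2 - X 2 * X 3 : CoordRing k) := by
  have h3 : Prime (X 0 ^ 2 - X 1 * X 2 : MvPolynomial (Fin 3) k) := by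
    rw [← Ideal.span_singleton_prime, ← ker_conicParam]
    · exact RingHom.ker_isPrime _
    · intro h
      have := congrArg (eval ![1, 0, 0]) h
      simp at this
  rw [← MulEquiv.prime_iff (finSuccEquiv k 3)]
  have : finSuccEquiv k 3 (X 1 ^ 2 - X 2 * X 3) =
      Polynomial.C (X 0 ^ 2 - X 1 * X 2 : MvPolynomial (Fin 3) k) := by
    rw [map_sub, map_mul, map_pow, show (1 : Fin 4) = Fin.succ 0 from rfl,
      show (2 : Fin 4) = Fin.succ 1 from rfl, show (3 : Fin 4) = Fin.succ 2 from rfl,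
      finSuccEquiv_X_succ, finSuccEquiv_X_succ, finSuccEquiv_X_succ]
    simp
  rw [this, Polynomial.prime_C_iff]
  exact h3

/-- The curve contains `(±δ, st, s², t²)` with `δ²` the value of the quartic. Both signs together
split a linear relation into `a₀ δ = 0` and a relation among `st`, `s²`, `t²`. -/
theorem isNondegenerate_of_conicParam_ne_zero [IsAlgClosed k] (h2 : (2 : k) ≠ 0)
    (hE : IsCoords fun i => E (X i)) {Z : ClosedSubscheme k} {q : MvPolynomial (Fin 3) k}
    (hq : conicParam k q ≠ 0)
    (hZ : Z.IsCutOutBy {E (X 1 ^ 2 - X 2 * X 3), E (X 0 ^ 2 - rename Fin.succ q)}) :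
    Z.IsNondegenerate := by
  refine isNondegenerate_of_eval hE hZ fun a ha => ?_
  have hev : ∀ s t : k, eval ![s, t] (conicParam k q) = eval ![s * t, s ^ 2, t ^ 2] q := by
    intro s t
    have : (aeval ![s, t] : MvPolynomial (Fin 2) k →ₐ[k] k).comp (conicParam k) =
        aeval ![s * t, s ^ 2, t ^ 2] := by
      ext1 i
      fin_cases i <;> simp [conicParam, aeval_eq_eval]
    simpa [aeval_eq_eval] using DFunLike.congr_fun this q
  have key : ∀ s t δ : k, (s ≠ 0 ∨ t ≠ 0) → δ ^ 2 = eval ![s, t] (conicParam k q) →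
      a 0 * δ + a 1 * (s * t) + a 2 * s ^ 2 + a 3 * t ^ 2 = 0 := by
    intro s t δ hst hδ
    have := ha ![δ, s * t, s ^ 2, t ^ 2] ?_ ?_
    · simpa [Fin.sum_univ_four] using this
    · intro h
      have h1 := congrFun h 2
      have h2 := congrFun h 3
      simp at h1 h2
      tauto
    · intro v hv
      simp only [eval_algEquiv, hv, map_sub, map_mul, map_pow, eval_cons_rename]
      refine ⟨by simp; ring, ?_⟩
      rw [← sub_eq_zero, hev] at hδ
      rw [← hδ]
      rfl
  have key2 : ∀ s t : k, (s ≠ 0 ∨ t ≠ 0) → a 0 * a 0 * eval ![s, t] (conicParam k q) = 0 ∧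
      a 1 * (s * t) + a 2 * s ^ 2 + a 3 * t ^ 2 = 0 := by
    intro s t hst
    obtain ⟨δ, hδ⟩ := IsAlgClosed.exists_pow_nat_eq (eval ![s, t] (conicParam k q)) zero_lt_two
    have e1 := key s t δ hst hδ
    have e2 := key s t (-δ) hst (by rw [neg_sq, hδ])
    have e3 : a 1 * (s * t) + a 2 * s ^ 2 + a 3 * t ^ 2 = 0 := by
      apply mul_left_cancel₀ h2
      linear_combination e1 + e2
    refine ⟨?_, e3⟩
    rw [← hδ]
    linear_combination a 0 * δ * (e1 - e3)
  have a2 : a 2 = 0 := by simpa using (key2 1 0 (by simp)).2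
  have a3 : a 3 = 0 := by simpa using (key2 0 1 (by simp)).2
  have a1 : a 1 = 0 := by simpa [a2, a3] using (key2 1 1 (by simp)).2
  have a0 : a 0 = 0 := by
    by_contra h0
    have : Infinite k := IsAlgClosed.instInfinite
    -- The factor `X 0` takes care of the origin, where `key2` says nothing.
    have : conicParam k q * X 0 = 0 := by
      refine MvPolynomial.funext fun v => ?_
      rw [map_mul, eval_X, map_zero]
      by_cases hv : v 0 = 0
      · rw [hv, mul_zero]
      · have := (key2 (v 0) (v 1) (Or.inl hv)).1
        rw [show ![v 0, v 1] = v by ext i; fin_cases i <;> rfl] at this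
        rw [(mul_eq_zero.1 this).resolve_left (mul_ne_zero h0 h0), zero_mul]
    exact hq ((mul_eq_zero.1 this).resolve_right (X_ne_zero 0))
  intro i
  fin_cases i <;> assumption

theorem isIrreducibleCurveOfDegree_four (hE : IsCoords fun i => E (X i)) {Z : ClosedSubscheme k}
    {q : MvPolynomial (Fin 3) k} (hq2 : q.IsHomogeneous 2)
    (hq : ¬ ∃ c, c ^ 2 = conicParam k q) (hnd : Z.IsNondegenerate)
    (hZ : Z.IsCutOutBy {E (X 1 ^ 2 - X 2 * X 3), E (X 0 ^ 2 - rename Fin.succ q)}) :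
    Z.IsIrreducibleCurveOfDegree 4 := by
  have hprime := map_isPrime_algEquiv E (isPrime_span_of_not_isSquare hq)
  rw [map_span_pair] at hprime
  have hX : E (X 1) ≠ 0 := (hE.2.ne_zero 1 :)
  have hZ' : Z.ideal = Ideal.span {E (X 1 ^ 2 - X 2 * X 3), E (X 0 ^ 2 - rename Fin.succ q)} := by
    rw [hZ]
    -- Nondegeneracy ensures that the prime ideal omits a linear form, hence is saturated.
    refine saturation_eq_self_of_isPrime hprime (hE.1 1) fun h => hX (hnd _ (hE.1 1) ?_)
    rw [hZ]
    exact Ideal.le_radical (le_saturation _ h)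
  refine ⟨hZ' ▸ hprime, ?_⟩
  have hg : (X 0 ^ 2 - rename Fin.succ q : CoordRing k).IsHomogeneous 2 :=
    ((isHomogeneous_X k 0).pow 2).sub hq2.rename_isHomogeneous
  -- At the vertex of the first cone the second quadric is 1 and the first is 0, so the first, being
  -- prime, does not divide it.
  have hg1 : eval (Pi.single 0 1) (X 0 ^ 2 - rename Fin.succ q : CoordRing k) = 1 := by
    have : Fin.tail (Pi.single 0 1 : Fin 4 → k) = 0 := by
      ext i
      simp [Fin.tail]
    rw [map_sub, eval_cons_rename, this, eval_zero_of_isHomogeneous (m := 1) hq2]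
    simp
  refine isCurveOfDegree_four (isHomogeneous_algEquiv hE isHomogeneous_conic_quadric)
    (isHomogeneous_algEquiv hE hg) ?_ ?_ ?_ hZ'
  · simpa only [Ne, EmbeddingLike.map_eq_zero_iff] using prime_conic_quadric.ne_zero
  · rw [Ne, EmbeddingLike.map_eq_zero_iff]
    intro h
    rw [h] at hg1
    simp at hg1
  · intro h hh
    have hp : Prime (E (X 1 ^ 2 - X 2 * X 3)) := (MulEquiv.prime_iff E).2 prime_conic_quadric
    refine (hp.dvd_or_dvd hh).resolve_left fun hd => ?_
    obtain ⟨c, hc⟩ := (map_dvd_iff E).1 hd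
    rw [hc] at hg1
    simp at hg1

/-- The root of the quartic is a binary quadratic form, that is, a combination of `st`, `s²`, `t²`,
which are the images of the three variables. -/
theorem exists_linear_of_sq_eq (h2 : (2 : k) ≠ 0) {q : MvPolynomial (Fin 3) k}
    (hq2 : q.IsHomogeneous 2) {c : MvPolynomial (Fin 2) k} (hc : c ^ 2 = conicParam k q) :
    ∃ r : MvPolynomial (Fin 3) k, r.IsHomogeneous 1 ∧ conicParam k r = c := by
  have h4 : (conicParam k q).IsHomogeneous 4 := by
    refine hq2.aeval (n := 2) _ fun i => ?_
    fin_cases i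
    · exact (isHomogeneous_X k 0).mul (isHomogeneous_X k 1)
    · exact isHomogeneous_X_pow _ _
    · exact isHomogeneous_X_pow _ _
  rw [← hc] at h4
  obtain ⟨a, hsymm, rfl⟩ := exists_eq_sum_C_mul_X_mul_X h2 (isHomogeneous_of_sq h4)
  refine ⟨∑ i, C (![2 * a 0 1, a 0 0, a 1 1] i) * X i, isHomogeneous_sum_C_mul_X _, ?_⟩
  simp only [conicParam, Fin.sum_univ_three, Fin.sum_univ_two, map_mul, map_add, algHom_C,
    algebraMap_eq, aeval_X, Matrix.cons_val, hsymm 1 0, map_ofNat]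
  ring

theorem isConeIntersection_of_conicParam_ne_zero (h2 : (2 : k) ≠ 0)
    (hE : IsCoords fun i => E (X i)) {Z : ClosedSubscheme k} {q : MvPolynomial (Fin 3) k}
    (hq2 : q.IsHomogeneous 2) (hq : conicParam k q ≠ 0) (hnd : Z.IsNondegenerate)
    (hZ : Z.IsCutOutBy {E (X 1 ^ 2 - X 2 * X 3), E (X 0 ^ 2 - rename Fin.succ q)}) :
    Z.IsConeIntersection := by
  by_cases hsq : ∃ c, c ^ 2 = conicParam k q
  · obtain ⟨c, hc⟩ := hsq
    obtain ⟨r, hr, rfl⟩ := exists_linear_of_sq_eq h2 hq2 hc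
    have hr0 : conicParam k r ≠ 0 := by
      intro h
      rw [h] at hc
      exact hq (by rw [← hc]; simp)
    obtain ⟨C₁, hC₁, hC₁'⟩ := exists_isSmoothConic h2 hE hr
    obtain ⟨C₂, hC₂, hC₂'⟩ := exists_isSmoothConic h2 hE hr.neg
    refine Or.inr (Or.inr (Or.inl ⟨C₁, C₂, hC₁, hC₂, ?_, ?_⟩))
    · intro h
      have hmem : E (X 0 - rename Fin.succ r) ∈ C₁.ideal := by
        rw [hC₁', mem_map_algEquiv, AlgEquiv.symm_apply_apply]
        exact Ideal.subset_span (by simp)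
      rw [h, hC₂', mem_map_algEquiv, AlgEquiv.symm_apply_apply, mem_conic_iff, map_sub, aeval_X,
        Fin.cons_zero, aeval_rename, map_sub, map_neg] at hmem
      simp only [Function.comp_def, Fin.cons_succ, aeval_X_left_apply] at hmem
      apply hr0
      have : C (2 : k) * conicParam k r = 0 := by
        rw [map_ofNat]
        linear_combination -hmem
      simpa [h2] using this
    · ext1
      change Z.ideal = C₁.ideal ⊓ C₂.ideal
      rw [hZ, ← C₁.saturated, ← C₂.saturated, ← saturation_inf, hC₁', hC₂', ← map_inf_algEquiv,
        ← conic_inf_conic h2 hr0 hc.symm, map_span_pair]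
  · exact Or.inl (isIrreducibleCurveOfDegree_four hE hq2 hsq hnd hZ)

theorem isConeIntersection_conic_doubledLine (h2 : (2 : k) ≠ 0) (hE : IsCoords fun i => E (X i))
    {Z : ClosedSubscheme k}
    (hZ : Z.IsCutOutBy {E (X 1 ^ 2 - X 2 * X 3), E (X 1 ^ 2 - X 0 * X 3)}) :
    Z.IsConeIntersection ∧ Z.IsNondegenerate := by
  constructor
  · obtain ⟨C, hC, hC'⟩ := exists_isSmoothConic h2 hE (isHomogeneous_X k 1)
    refine Or.inr (Or.inr (Or.inr ⟨C, cutOut {E (X 3), E (X 1) ^ 2} ?_, hC,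
      ⟨E (X 3), E (X 1), hE.1 3, hE.1 1, ?_, rfl⟩, ?_⟩))
    · rintro _ (rfl | rfl)
      exacts [⟨1, hE.1 3⟩, ⟨_, (hE.1 1).pow 2⟩]
    · convert hE.2.comp ![3, 1] (by decide) using 1
      ext i
      fin_cases i <;> rfl
    · ext1
      change Z.ideal = C.ideal ⊓ saturation _
      rw [hZ, ← C.saturated, ← saturation_inf, hC', ← map_pow, ← map_span_pair,
        ← map_span_pair, ← map_inf_algEquiv,
        ← conic_inf_doubledLine]
  · refine isNondegenerate_of_eval hE hZ fun a ha => ?_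
    have key : ∀ s t : k, (s ≠ 0 ∨ t ≠ 0) →
        a 0 * s ^ 2 + a 1 * (s * t) + a 2 * s ^ 2 + a 3 * t ^ 2 = 0 := by
      intro s t hst
      have := ha ![s ^ 2, s * t, s ^ 2, t ^ 2] ?_ ?_
      · simpa [Fin.sum_univ_four] using this
      · intro h
        have h1 := congrFun h 2
        have h2 := congrFun h 3
        simp at h1 h2
        tauto
      · intro v hv
        simp only [hv, map_sub, map_mul, map_pow]
        constructor <;> simp <;> ring
    -- The conic lies in the plane where coordinates 0 and 2 agree; this point of the doubled line
    -- lies off that plane.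
    have a0 : a 0 = 0 := by
      have := ha ![1, 0, 0, 0] (by simp) fun v hv => by
        simp [hv]
      simpa [Fin.sum_univ_four] using this
    have a2 : a 2 = 0 := by simpa [a0] using key 1 0 (by simp)
    have a3 : a 3 = 0 := by simpa using key 0 1 (by simp)
    have a1 : a 1 = 0 := by simpa [a0, a2, a3] using key 1 1 (by simp)
    intro i
    fin_cases i <;> assumption

theorem exists_isTwistedCubic (h2 : (2 : k) ≠ 0) (hE : IsCoords fun i => E (X i))
    (hE' : ∀ i, (E.symm (X i)).IsHomogeneous 1) :
    ∃ C : ClosedSubscheme k, C.IsTwistedCubic ∧ C.ideal =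
      (Ideal.span {X 1 * X 2 - X 3 ^ 2, X 0 * X 3 - X 2 ^ 2, X 0 * X 1 - X 2 * X 3}).map E := by
  have hX : ∀ i j : Fin 4, (X i * X j : CoordRing k).IsHomogeneous 2 :=
    fun i j => (isHomogeneous_X k i).mul (isHomogeneous_X k j)
  have hprime : (Ideal.span {X 1 * X 2 - X 3 ^ 2, X 0 * X 3 - X 2 ^ 2, X 0 * X 1 - X 2 * X 3} :
      Ideal (CoordRing k)).IsPrime := by
    rw [← ker_cubicParam]
    exact RingHom.ker_isPrime _
  have hsat := saturation_eq_self_of_isPrime (map_isPrime_algEquiv E hprime) (hE.1 0) (by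
    rw [mem_map_algEquiv, AlgEquiv.symm_apply_apply, ← ker_cubicParam, RingHom.mem_ker, aeval_X]
    simp [cubicParam])
  have himg : (Ideal.span {X 1 * X 2 - X 3 ^ 2, X 0 * X 3 - X 2 ^ 2, X 0 * X 1 - X 2 * X 3}).map E =
      Ideal.span (E '' {X 1 * X 2 - X 3 ^ 2, X 0 * X 3 - X 2 ^ 2, X 0 * X 1 - X 2 * X 3}) :=
    Ideal.map_span _ _
  refine ⟨cutOut (E '' {X 1 * X 2 - X 3 ^ 2, X 0 * X 3 - X 2 ^ 2, X 0 * X 1 - X 2 * X 3}) ?_, ?_, ?_⟩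
  · rintro _ ⟨f, hf, rfl⟩
    refine ⟨2, isHomogeneous_algEquiv hE ?_⟩
    rcases hf with rfl | rfl | rfl
    · exact (hX 1 2).sub (sq (X 3 : CoordRing k) ▸ hX 3 3)
    · exact (hX 0 3).sub (sq (X 2 : CoordRing k) ▸ hX 2 2)
    · exact (hX 0 1).sub (hX 2 3)
  · have hcubic : ∀ i, (cubicParam k i).IsHomogeneous 3 := by
      intro i
      fin_cases i
      · exact isHomogeneous_X_pow _ _
      · exact isHomogeneous_X_pow _ _
      · exact ((isHomogeneous_X k 0).pow 2).mul (isHomogeneous_X k 1)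
      · exact (isHomogeneous_X k 0).mul ((isHomogeneous_X k 1).pow 2)
    have hcli : LinearIndependent k (cubicParam k) := by
      refine linearIndependent_of_eval fun a ha => ?_
      have key : ∀ s t : k, a 0 * s ^ 3 + a 1 * t ^ 3 + a 2 * (s ^ 2 * t) + a 3 * (s * t ^ 2) = 0 := by
        intro s t
        simpa [cubicParam, Fin.sum_univ_four] using ha ![s, t]
      have a0 : a 0 = 0 := by simpa using key 1 0
      have a1 : a 1 = 0 := by simpa using key 0 1
      have e1 := key 1 1
      have e2 := key 1 (-1)
      rw [a0, a1] at e1 e2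
      have a2 : a 2 = 0 := by
        apply mul_left_cancel₀ h2
        linear_combination e1 - e2
      have a3 : a 3 = 0 := by
        rw [a2] at e1
        simpa using e1
      intro i
      fin_cases i <;> assumption
    -- The standard parametrization, read in the original variables.
    refine ⟨fun i => aeval (cubicParam k) (E.symm (X i)), fun i => ?_, ?_, ?_⟩
    · simpa using (hE' i).aeval _ hcubic
    · rw [Fintype.linearIndependent_iff] at hcli ⊢
      intro g hg
      obtain ⟨b, hb⟩ := exists_eq_sum_C_mul_X (IsHomogeneous.sum Finset.univ
        (fun i => C (g i) * E.symm (X i)) 1 fun i _ => (hE' i).C_mul _)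
      have hb' := congrArg (aeval (cubicParam k)) hb
      have hz : ∑ i, b i • cubicParam k i = 0 := by
        rw [← hg]
        simpa [smul_eq_C_mul] using hb'.symm
      have hb0 : ∀ i, b i = 0 := hcli b hz
      simp only [hb0, map_zero, zero_mul, Finset.sum_const_zero] at hb
      have h := congrArg E hb
      simp only [map_sum, map_mul, AlgEquiv.apply_symm_apply, map_zero, ← algebraMap_eq,
        AlgEquiv.commutes] at h
      intro i
      have := congrArg (eval (Pi.single i 1)) h
      simpa [Pi.single_apply] using this
    · change saturation _ = _
      rw [← himg, hsat]
      ext p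
      rw [mem_map_algEquiv, ← ker_cubicParam, RingHom.mem_ker, RingHom.mem_ker]
      have : (aeval fun i => aeval (cubicParam k) (E.symm (X i))) =
          (aeval (cubicParam k) : CoordRing k →ₐ[k] _).comp
            (E.symm : CoordRing k →ₐ[k] CoordRing k) := by
        ext1 i
        simp
      rw [this]
      rfl
  · change saturation _ = _
    rw [← himg, hsat]

theorem isConeIntersection_twistedCubic_line (h2 : (2 : k) ≠ 0) (hE : IsCoords fun i => E (X i))
    (hE' : ∀ i, (E.symm (X i)).IsHomogeneous 1) {Z : ClosedSubscheme k}
    (hZ : Z.IsCutOutBy {E (X 1 * X 2 - X 3 ^ 2), E (X 0 * X 3 - X 2 ^ 2)}) :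
    Z.IsConeIntersection ∧ Z.IsNondegenerate := by
  constructor
  · obtain ⟨C, hC, hC'⟩ := exists_isTwistedCubic h2 hE hE'
    refine Or.inr (Or.inl ⟨C, cutOut {E (X 2), E (X 3)} ?_, hC,
      ⟨E (X 2), E (X 3), hE.1 2, hE.1 3, ?_, rfl⟩, ?_⟩)
    · rintro _ (rfl | rfl)
      exacts [⟨1, hE.1 2⟩, ⟨1, hE.1 3⟩]
    · convert hE.2.comp ![2, 3] (by decide) using 1
      ext i
      fin_cases i <;> rfl
    · ext1
      change Z.ideal = C.ideal ⊓ saturation _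
      rw [hZ, ← C.saturated, ← saturation_inf, hC', ← map_span_pair,
        ← map_span_pair, ← map_inf_algEquiv, ← twistedCubic_inf_line]
  · refine isNondegenerate_of_eval hE hZ fun a ha => ?_
    have key : ∀ s t : k, (s ≠ 0 ∨ t ≠ 0) →
        a 0 * s ^ 3 + a 1 * t ^ 3 + a 2 * (s ^ 2 * t) + a 3 * (s * t ^ 2) = 0 := by
      intro s t hst
      have := ha ![s ^ 3, t ^ 3, s ^ 2 * t, s * t ^ 2] ?_ ?_
      · simpa [Fin.sum_univ_four] using this
      · intro h
        have h1 := congrFun h 0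
        have h2 := congrFun h 1
        simp at h1 h2
        tauto
      · intro v hv
        simp only [hv, map_sub, map_mul, map_pow]
        constructor <;> simp <;> ring
    have a0 : a 0 = 0 := by simpa using key 1 0 (by simp)
    have a1 : a 1 = 0 := by simpa using key 0 1 (by simp)
    have e1 := key 1 1 (by simp)
    have e2 := key 1 (-1) (by simp)
    rw [a0, a1] at e1 e2
    have a2 : a 2 = 0 := by
      apply mul_left_cancel₀ h2
      linear_combination e1 - e2
    have a3 : a 3 = 0 := by
      rw [a2] at e1
      simpa using e1
    intro i
    fin_cases i <;> assumption

end ClosedSubscheme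

end Cases

/-! ### Two cones: reduction to the cases, and the lines on a cone -/

section TwoCones

theorem isHomogeneous_mul_sub_sq {n : ℕ} {ξ : Fin 3 → MvPolynomial (Fin n) k}
    (hξ : ∀ i, (ξ i).IsHomogeneous 1) : (ξ 1 * ξ 2 - ξ 0 ^ 2).IsHomogeneous 2 :=
  ((hξ 1).mul (hξ 2)).sub ((hξ 0).pow 2)

/-- Completing the square in a variable that is nonzero at `p`; its square has a nonzero coefficient
because `F` does not vanish at `p`. -/
theorem exists_eq_C_mul_sq_sub (h2 : (2 : k) ≠ 0) {ξ : Fin 3 → CoordRing k}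
    (hξ : ∀ i, (ξ i).IsHomogeneous 1) (hli : LinearIndependent k ξ) {p : Fin 4 → k}
    (hp : ∀ i, eval p (ξ i) = 0) {F : CoordRing k} (hF : F.IsHomogeneous 2)
    (hFp : eval p F ≠ 0) :
    ∃ (x : CoordRing k) (c : k) (q : MvPolynomial (Fin 3) k), x.IsHomogeneous 1 ∧ eval p x ≠ 0 ∧
      c ≠ 0 ∧ q.IsHomogeneous 2 ∧ F = C c * (x ^ 2 - aeval ξ q) := by
  have hp0 : p ≠ 0 := by
    rintro rfl
    exact hFp (eval_zero_of_isHomogeneous (m := 1) hF)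
  obtain ⟨i, hi⟩ := Function.ne_iff.1 hp0
  have hi : p i ≠ 0 := hi
  have hΞ := isCoords_cons hξ hli hp (isHomogeneous_X k i) (by simpa using hi)
  obtain ⟨a, hsymm, ha⟩ := hΞ.exists_eq_sum_sum h2 hF
  have ha : F = C (a 0 0) * X i ^ 2 + 2 * X i * ∑ j, C (a 0 (Fin.succ j)) * ξ j +
      ∑ r, ∑ j, C (a (Fin.succ r) (Fin.succ j)) * ξ r * ξ j := by
    rw [ha]
    simp only [Fin.sum_univ_succ (n := 3), Fin.cons_zero, Fin.cons_succ, Finset.sum_add_distrib,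
      hsymm (Fin.succ _) 0, Finset.mul_sum]
    rw [sq, ← add_assoc, mul_assoc, add_assoc (C (a 0 0) * (X i * X i)),
      ← Finset.sum_add_distrib]
    congr 2
    exact Finset.sum_congr rfl fun j _ => by ring
  have h00 : a 0 0 ≠ 0 := by
    intro h0
    apply hFp
    rw [ha]
    simp [hp, h0]
  have hc : C (a 0 0) * C (a 0 0)⁻¹ = (1 : CoordRing k) := by
    rw [← C_mul, mul_inv_cancel₀ h00, C_1]
  let L : MvPolynomial (Fin 3) k := ∑ j, C (a 0 (Fin.succ j)) * X j
  have hL : L.IsHomogeneous 1 := isHomogeneous_sum_C_mul_X _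
  let M : MvPolynomial (Fin 3) k := ∑ i, ∑ j, C (a (Fin.succ i) (Fin.succ j)) * X i * X j
  have hM : M.IsHomogeneous 2 := IsHomogeneous.sum _ _ _ fun i _ => IsHomogeneous.sum _ _ _
    fun j _ => (isHomogeneous_C_mul_X _ i).mul (isHomogeneous_X _ j)
  have hLξ : (aeval ξ L).IsHomogeneous 1 := by simpa using hL.aeval ξ hξ
  refine ⟨X i + C (a 0 0)⁻¹ * aeval ξ L, a 0 0,
    C (a 0 0)⁻¹ * (C (a 0 0)⁻¹ * L ^ 2 - M), (isHomogeneous_X k i).add (hLξ.C_mul _), ?_, h00,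
    (((hL.pow 2).C_mul _).sub hM).C_mul _, ?_⟩
  · simp [L, hp, hi]
  · have hL' : aeval ξ L = ∑ j, C (a 0 (Fin.succ j)) * ξ j := by
      simp only [L, map_sum, map_mul, algHom_C, algebraMap_eq, aeval_X]
    have hM' : aeval ξ M = ∑ r, ∑ j, C (a (Fin.succ r) (Fin.succ j)) * ξ r * ξ j := by
      simp only [M, map_sum, map_mul, algHom_C, algebraMap_eq, aeval_X]
    rw [ha, ← hL', ← hM']
    simp only [map_mul, map_sub, map_pow, algHom_C, algebraMap_eq]
    linear_combination (-2 * X i * aeval ξ L - aeval ξ M) * hc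

/-- The left side has rank 3, the right side rank 1 for `d = 0` and rank 4 otherwise. For `d = 0`
the zeros of the right side form a linear space, unlike those of the left; for `d ≠ 0` the right
side is not invariant under translation by a nonzero `p`. -/
theorem not_forall_eval_eq_of_isCoords (h2 : (2 : k) ≠ 0) {ξ ξ' : Fin 3 → CoordRing k}
    {x : CoordRing k} (hΞ : IsCoords (Fin.cons x ξ : Fin 4 → CoordRing k))
    (hξ' : ∀ i, (ξ' i).IsHomogeneous 1) (hli' : LinearIndependent k ξ') {p : Fin 4 → k}
    (hp0 : p ≠ 0) (hp : ∀ i, eval p (ξ' i) = 0) {c d : k} (hc : c ≠ 0)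
    (h : ∀ v, eval v (ξ' 1) * eval v (ξ' 2) - eval v (ξ' 0) ^ 2 =
      c * (eval v x ^ 2 - d * (eval v (ξ 0) ^ 2 - eval v (ξ 1) * eval v (ξ 2)))) : False := by
  have hx : x.IsHomogeneous 1 := hΞ.1 0
  have hξ : ∀ i, (ξ i).IsHomogeneous 1 := fun i => hΞ.1 i.succ
  by_cases hd : d = 0
  · subst hd
    obtain ⟨v, hv⟩ := exists_forall_eval_eq hξ' hli' ![0, 1, 0]
    obtain ⟨w, hw⟩ := exists_forall_eval_eq hξ' hli' ![0, 0, 1]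
    have e1 := h v
    have e2 := h w
    have e3 := h (v + w)
    simp only [eval_add_of_isHomogeneous_one (hξ' _), eval_add_of_isHomogeneous_one hx, hv, hw]
      at e1 e2 e3
    have hxv : eval v x = 0 := by simpa [hc] using e1.symm
    have hxw : eval w x = 0 := by simpa [hc] using e2.symm
    simp [hxv, hxw] at e3
  · have key : ∀ v, eval (p + v) x ^ 2 - d * (eval (p + v) (ξ 0) ^ 2 -
        eval (p + v) (ξ 1) * eval (p + v) (ξ 2)) =
        eval v x ^ 2 - d * (eval v (ξ 0) ^ 2 - eval v (ξ 1) * eval v (ξ 2)) := by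
      intro v
      apply mul_left_cancel₀ hc
      rw [← h, ← h]
      simp only [eval_add_of_isHomogeneous_one (hξ' _), hp, zero_add]
    simp only [eval_add_of_isHomogeneous_one (hξ _), eval_add_of_isHomogeneous_one hx] at key
    have pt : ∀ u : Fin 4 → k, ∃ v, eval v x = u 0 ∧ ∀ i : Fin 3, eval v (ξ i) = u i.succ := by
      intro u
      obtain ⟨v, hv⟩ := exists_forall_eval_eq hΞ.1 hΞ.2 u
      exact ⟨v, hv 0, fun i => hv i.succ⟩
    have shift : ∀ a b e : k,
        (eval p x) ^ 2 - d * ((eval p (ξ 0) + a) ^ 2 -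
          (eval p (ξ 1) + b) * (eval p (ξ 2) + e)) = - d * (a ^ 2 - b * e) := by
      intro a b e
      obtain ⟨v, hv, hv'⟩ := pt ![0, a, b, e]
      have := key v
      rw [hv, hv', hv', hv'] at this
      simpa using this
    have e0 := shift 0 0 0
    have z2 : eval p (ξ 2) = 0 := by
      apply mul_left_cancel₀ hd
      linear_combination shift 0 1 0 - e0
    have z1 : eval p (ξ 1) = 0 := by
      apply mul_left_cancel₀ hd
      linear_combination shift 0 0 1 - e0
    have z0 : eval p (ξ 0) = 0 := by
      apply mul_left_cancel₀ (mul_ne_zero hd h2)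
      linear_combination -(shift 1 0 0 - e0)
    have zx : eval p x = 0 := by
      rw [z0, z1, z2] at e0
      simpa using e0
    refine hp0 (hΞ.eq_zero fun i => ?_)
    fin_cases i
    exacts [zx, z0, z1, z2]

theorem exists_eq_C_mul_of_conicParam_eq_zero {q : MvPolynomial (Fin 3) k}
    (hq2 : q.IsHomogeneous 2) (hq : conicParam k q = 0) :
    ∃ d : k, q = C d * (X 0 ^ 2 - X 1 * X 2) := by
  rw [← RingHom.mem_ker, ker_conicParam, Ideal.mem_span_singleton] at hq
  obtain ⟨c, rfl⟩ := hq
  have hg : (X 0 ^ 2 - X 1 * X 2 : MvPolynomial (Fin 3) k).IsHomogeneous 2 :=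
    ((isHomogeneous_X k 0).pow 2).sub ((isHomogeneous_X k 1).mul (isHomogeneous_X k 2))
  have := homogeneousComponent_mul_of_isHomogeneous hg c 0
  rw [mul_comm c, homogeneousComponent_eq_self hq2, homogeneousComponent_zero] at this
  exact ⟨_, this⟩

namespace ClosedSubscheme

theorem isConeIntersection_of_eval_ne_zero [IsAlgClosed k] (h2 : (2 : k) ≠ 0)
    {Z : ClosedSubscheme k} {ξ ξ' : Fin 3 → CoordRing k} {p p' : Fin 4 → k}
    (hξ : ∀ i, (ξ i).IsHomogeneous 1) (hli : LinearIndependent k ξ) (hp : ∀ i, eval p (ξ i) = 0)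
    (hξ' : ∀ i, (ξ' i).IsHomogeneous 1) (hli' : LinearIndependent k ξ') (hp0' : p' ≠ 0)
    (hp' : ∀ i, eval p' (ξ' i) = 0) (hZ : Z.IsCutOutBy {ξ 1 * ξ 2 - ξ 0 ^ 2, ξ' 1 * ξ' 2 - ξ' 0 ^ 2})
    (hne : eval p (ξ' 1 * ξ' 2 - ξ' 0 ^ 2) ≠ 0) : Z.IsConeIntersection ∧ Z.IsNondegenerate := by
  obtain ⟨x, c, q, hx, hxp, hc, hq2, hF⟩ :=
    exists_eq_C_mul_sq_sub h2 hξ hli hp (isHomogeneous_mul_sub_sq hξ') hne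
  have hΞ := isCoords_cons hξ hli hp hx hxp
  obtain ⟨E, hE, -⟩ := hΞ.exists_algEquiv
  have hΞE : IsCoords fun i => E (X i) := by
    rw [funext hE]
    exact hΞ
  have hEr : ∀ r, E (rename Fin.succ r) = aeval ξ r := by
    intro r
    have : (E : CoordRing k →ₐ[k] CoordRing k).comp (rename Fin.succ) = aeval ξ := by
      ext1 i
      simp [hE]
    exact DFunLike.congr_fun this r
  have hZ' : Z.IsCutOutBy {E (X 1 ^ 2 - X 2 * X 3), E (X 0 ^ 2 - rename Fin.succ q)} := by
    have e1 : ξ 1 * ξ 2 - ξ 0 ^ 2 = C (-1) * E (X 1 ^ 2 - X 2 * X 3) := by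
      rw [map_sub, map_mul, map_pow, hE, hE, hE]
      change _ = C (-1) * (ξ 0 ^ 2 - ξ 1 * ξ 2)
      rw [C_neg, C_1]
      ring
    have e2 : ξ' 1 * ξ' 2 - ξ' 0 ^ 2 = C c * E (X 0 ^ 2 - rename Fin.succ q) := by
      rw [hF, map_sub, map_pow, hE, hEr, Fin.cons_zero]
    rw [e1, e2] at hZ
    rwa [IsCutOutBy, span_pair_C_mul (neg_ne_zero.2 one_ne_zero) hc] at hZ
  have hq : conicParam k q ≠ 0 := by
    intro h
    obtain ⟨d, rfl⟩ := exists_eq_C_mul_of_conicParam_eq_zero hq2 h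
    refine not_forall_eval_eq_of_isCoords (d := d) h2 hΞ hξ' hli' hp0' hp' hc fun v => ?_
    have := congrArg (eval v) hF
    simpa using this
  have hnd := isNondegenerate_of_conicParam_ne_zero h2 hΞE hq hZ'
  exact ⟨isConeIntersection_of_conicParam_ne_zero h2 hΞE hq2 hq hnd hZ', hnd⟩

/-- The line joining the vertices is `ξ₀ = ξ₂ = 0`, and `ξ₂ = 0`, `ξ'₂ = 0` are the tangent planes
along it. They coincide exactly when the coefficient `β` of `ξ₀` in `ξ'₂` is zero. -/
theorem isConeIntersection_of_common_line (h2 : (2 : k) ≠ 0)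
    {Z : ClosedSubscheme k} {ξ ξ' : Fin 3 → CoordRing k} {p p' : Fin 4 → k}
    (hξ : ∀ i, (ξ i).IsHomogeneous 1) (hli : LinearIndependent k ξ) (hp : ∀ i, eval p (ξ i) = 0)
    (hξ' : ∀ i, (ξ' i).IsHomogeneous 1) (hli' : LinearIndependent k ξ')
    (hp' : ∀ i, eval p' (ξ' i) = 0) (hp0 : eval p' (ξ 0) = 0) (hp2 : eval p' (ξ 2) = 0)
    (hp1 : eval p' (ξ 1) ≠ 0) (hp0' : eval p (ξ' 0) = 0) (hp2' : eval p (ξ' 2) = 0)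
    (hp1' : eval p (ξ' 1) ≠ 0)
    (hZ : Z.IsCutOutBy {ξ 1 * ξ 2 - ξ 0 ^ 2, ξ' 1 * ξ' 2 - ξ' 0 ^ 2}) :
    Z.IsConeIntersection ∧ Z.IsNondegenerate := by
  have hΞ := isCoords_cons hξ hli hp (hξ' 1) hp1'
  have hlin : ∀ l : CoordRing k, l.IsHomogeneous 1 → eval p l = 0 → eval p' l = 0 →
      ∃ b a : k, l = C b * ξ 0 + C a * ξ 2 := by
    intro l hl hlp hlp'
    obtain ⟨a, rfl⟩ := hΞ.exists_eq_sum hl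
    have hsum : ∑ i, C (a i) * (Fin.cons (ξ' 1) ξ : Fin 4 → CoordRing k) i =
        C (a 0) * ξ' 1 + C (a 1) * ξ 0 + C (a 2) * ξ 1 + C (a 3) * ξ 2 := Fin.sum_univ_four _
    rw [hsum] at hlp hlp' ⊢
    have a0 : a 0 = 0 := by simpa [hp, hp1'] using hlp
    have a2 : a 2 = 0 := by simpa [hp', hp0, hp1, hp2] using hlp'
    exact ⟨a 1, a 3, by simp [a0, a2]⟩
  obtain ⟨β, α, hα⟩ := hlin _ (hξ' 2) hp2' (hp' 2)
  obtain ⟨δ, γ, hγ⟩ := hlin _ (hξ' 0) hp0' (hp' 0)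
  -- Values at `t` and `t'` record the independence of `ξ'₀` and `ξ'₂`, which makes `α`, `δ` and
  -- later `κ` nonzero.
  obtain ⟨t, ht⟩ := exists_forall_eval_eq hξ' hli' ![1, 0, 0]
  obtain ⟨t', ht'⟩ := exists_forall_eval_eq hξ' hli' ![0, 0, 1]
  have t0 := congrArg (eval t) hγ
  have t2 := congrArg (eval t) hα
  have t2' := congrArg (eval t') hα
  simp only [ht, ht', map_add, map_mul, eval_C, Matrix.cons_val] at t0 t2 t2'
  by_cases hβ : β = 0
  · subst hβ
    have hα0 : α ≠ 0 := by
      rintro rfl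
      simp at t2'
    have hδ0 : δ ≠ 0 := by
      rintro rfl
      have : eval t (ξ 2) = 0 := by simpa [hα0] using t2.symm
      simp [this] at t0
    -- Solves `ξ'₁ξ'₂ - ξ'₀² = -δ² (ξ₀² - x ξ₂)` for `x`.
    let x : CoordRing k := C (δ ^ 2)⁻¹ * (C α * ξ' 1 - C (γ ^ 2) * ξ 2 - C (2 * γ * δ) * ξ 0)
    have hx : x.IsHomogeneous 1 :=
      ((((hξ' 1).C_mul _).sub ((hξ 2).C_mul _)).sub ((hξ 0).C_mul _)).C_mul _
    have hxp : eval p x ≠ 0 := by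
      simp [x, hp, hα0, hδ0, hp1']
    obtain ⟨E, hE, -⟩ := (isCoords_cons hξ hli hp hx hxp).exists_algEquiv
    refine isConeIntersection_conic_doubledLine (E := E) h2 ?_ ?_
    · rw [funext hE]
      exact isCoords_cons hξ hli hp hx hxp
    · have e1 : ξ 1 * ξ 2 - ξ 0 ^ 2 = C (-1) * E (X 1 ^ 2 - X 2 * X 3) := by
        rw [map_sub, map_mul, map_pow, hE, hE, hE]
        change _ = C (-1) * (ξ 0 ^ 2 - ξ 1 * ξ 2)
        rw [C_neg, C_1]
        ring
      have e2 : ξ' 1 * ξ' 2 - ξ' 0 ^ 2 = C (-δ ^ 2) * E (X 1 ^ 2 - X 0 * X 3) := by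
        rw [map_sub, map_mul, map_pow, hE, hE, hE]
        change _ = C (-δ ^ 2) * (ξ 0 ^ 2 - x * ξ 2)
        have hc : C δ ^ 2 * C (δ ^ 2)⁻¹ = (1 : CoordRing k) := by
          rw [← C_pow, ← C_mul, mul_inv_cancel₀ (pow_ne_zero 2 hδ0), C_1]
        rw [hα, hγ]
        simp only [x, C_neg, C_pow, C_mul, C_0, map_ofNat]
        linear_combination -ξ 2 * (C α * ξ' 1 - C γ ^ 2 * ξ 2 - 2 * C γ * C δ * ξ 0) * hc
      rw [e1, e2] at hZ
      rwa [IsCutOutBy, span_pair_C_mul (neg_ne_zero.2 one_ne_zero)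
        (neg_ne_zero.2 (pow_ne_zero 2 hδ0))] at hZ
  · set e := α / β with he
    set κ := γ - δ * e with hκ
    have hα' : α = β * e := by rw [he]; field_simp
    have hγ' : γ = κ + δ * e := by rw [hκ]; ring
    have hκ0 : κ ≠ 0 := by
      intro h0
      rw [hγ', h0] at t0
      rw [hα'] at t2
      have h3 : β * 1 = 0 := by linear_combination β * t0 - δ * t2
      exact hβ (by simpa using h3)
    -- With `ξ'₂ = β w` and `ξ'₀ = δ w + κ ξ₂`, the forms `y` and `x` are chosen so that the two
    -- equations become `y ξ₂ = w²` and `x w = ξ₂²`.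
    let w : CoordRing k := ξ 0 + C e * ξ 2
    let y : CoordRing k := ξ 1 + C (2 * e) * ξ 0 + C (e ^ 2) * ξ 2
    let x : CoordRing k := C (κ ^ 2)⁻¹ * (C β * ξ' 1 - C (δ ^ 2) * w - C (2 * δ * κ) * ξ 2)
    have hw : w.IsHomogeneous 1 := (hξ 0).add ((hξ 2).C_mul _)
    have hcoords : IsCoords ![x, y, ξ 2, w] := by
      constructor
      · intro i
        fin_cases i
        · exact ((((hξ' 1).C_mul _).sub (hw.C_mul _)).sub ((hξ 2).C_mul _)).C_mul _
        · exact ((hξ 1).add ((hξ 0).C_mul _)).add ((hξ 2).C_mul _)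
        · exact hξ 2
        · exact hw
      · refine linearIndependent_of_eval fun a ha => ?_
        have pt : ∀ u : Fin 4 → k, ∃ v, eval v (ξ' 1) = u 0 ∧
            eval v (ξ 0) = u 1 ∧ eval v (ξ 1) = u 2 ∧ eval v (ξ 2) = u 3 := by
          intro u
          obtain ⟨v, hv⟩ := exists_forall_eval_eq hΞ.1 hΞ.2 u
          exact ⟨v, hv 0, hv 1, hv 2, hv 3⟩
        simp only [Fin.sum_univ_four, Matrix.cons_val, x, y, w, map_add, map_sub, map_mul,
          eval_C] at ha
        have a0 : a 0 = 0 := by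
          obtain ⟨v, h0, h1, h2, h3⟩ := pt ![1, 0, 0, 0]
          have := ha v
          simpa [h0, h1, h2, h3, hβ, hκ0] using this
        have a1 : a 1 = 0 := by
          obtain ⟨v, h0, h1, h2, h3⟩ := pt ![0, 0, 1, 0]
          have := ha v
          simpa [h0, h1, h2, h3, a0] using this
        have a3 : a 3 = 0 := by
          obtain ⟨v, h0, h1, h2, h3⟩ := pt ![0, 1, 0, 0]
          have := ha v
          simpa [h0, h1, h2, h3, a0, a1] using this
        have a2 : a 2 = 0 := by
          obtain ⟨v, h0, h1, h2, h3⟩ := pt ![0, 0, 0, 1]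
          have := ha v
          simpa [h0, h1, h2, h3, a0, a1, a3] using this
        intro i
        fin_cases i <;> assumption
    obtain ⟨E, hE, hE'⟩ := hcoords.exists_algEquiv
    refine isConeIntersection_twistedCubic_line (E := E) h2 ?_ hE' ?_
    · rw [funext hE]
      exact hcoords
    · have e1 : ξ 1 * ξ 2 - ξ 0 ^ 2 = C 1 * E (X 1 * X 2 - X 3 ^ 2) := by
        rw [map_sub, map_mul, map_pow, hE, hE, hE]
        change _ = C 1 * (y * ξ 2 - w ^ 2)
        simp only [y, w, C_1, C_pow, C_mul, map_ofNat]
        ring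
      have e2 : ξ' 1 * ξ' 2 - ξ' 0 ^ 2 = C (κ ^ 2) * E (X 0 * X 3 - X 2 ^ 2) := by
        have hE2 : E (X 0 * X 3 - X 2 ^ 2) = x * w - ξ 2 ^ 2 := by
          rw [map_sub, map_mul, map_pow, hE, hE, hE]
          rfl
        rw [hE2]
        have hc : C κ ^ 2 * C (κ ^ 2)⁻¹ = (1 : CoordRing k) := by
          rw [← C_pow, ← C_mul, mul_inv_cancel₀ (pow_ne_zero 2 hκ0), C_1]
        rw [hα, hγ, hα', hγ']
        simp only [x, w, C_add, C_pow, C_mul, map_ofNat]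
        linear_combination (-(C β * ξ' 1 - C δ ^ 2 * (ξ 0 + C e * ξ 2) -
          2 * C δ * C κ * ξ 2)) * (ξ 0 + C e * ξ 2) * hc
      rw [e1, e2] at hZ
      rwa [IsCutOutBy, span_pair_C_mul one_ne_zero (pow_ne_zero 2 hκ0)] at hZ

/-- The line meets the planes `ξ₂ = 0` and `ξ₁ = 0`, and `ξ₀` vanishes at these points `u` and `v`.
If neither were the vertex, then `u + v` would be on the line with `ξ₁ξ₂ ≠ 0 = ξ₀²`. -/
theorem eval_eq_zero_of_isConicCone_contains {Z L : ClosedSubscheme k} {ξ : Fin 3 → CoordRing k}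
    {p : Fin 4 → k} (hp0 : p ≠ 0) (hξ : ∀ i, (ξ i).IsHomogeneous 1)
    (hli : LinearIndependent k ξ) (hp : ∀ i, eval p (ξ i) = 0)
    (hmem : ξ 1 * ξ 2 - ξ 0 ^ 2 ∈ Z.ideal) (hZL : Z.Contains L) {l m : CoordRing k}
    (hl : l.IsHomogeneous 1) (hm : m.IsHomogeneous 1) (hL : L.IsCutOutBy {l, m}) :
    eval p l = 0 ∧ eval p m = 0 := by
  have hQ : ∀ v, eval v l = 0 → eval v m = 0 →
      eval v (ξ 1) * eval v (ξ 2) = eval v (ξ 0) ^ 2 := by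
    intro v hvl hvm
    by_cases hv : v = 0
    · have hz := fun i => eval_zero_of_isHomogeneous (m := 0) (hξ i)
      rw [hv, hz, hz, hz]
      ring
    · have h := hZL hmem
      rw [hL] at h
      have := eval_eq_zero_of_mem_saturation_span hv (by rintro _ (rfl | rfl) <;> assumption) h
      rw [← sub_eq_zero]
      simpa using this
  have hpt : ∀ v, v ≠ 0 → eval v l = 0 → eval v m = 0 → (∀ i, eval v (ξ i) = 0) →
      eval p l = 0 ∧ eval p m = 0 := by
    intro v hv hvl hvm hvξ
    obtain ⟨c, rfl⟩ := exists_eq_smul_of_eval_eq_zero hξ hli hp0 hp hvξ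
    have hc : c ≠ 0 := by
      rintro rfl
      simp at hv
    rw [eval_smul_of_isHomogeneous_one hl] at hvl
    rw [eval_smul_of_isHomogeneous_one hm] at hvm
    exact ⟨(mul_eq_zero.1 hvl).resolve_left hc, (mul_eq_zero.1 hvm).resolve_left hc⟩
  have hex : ∀ f : CoordRing k, f.IsHomogeneous 1 →
      ∃ v, v ≠ 0 ∧ eval v l = 0 ∧ eval v m = 0 ∧ eval v f = 0 := by
    intro f hf
    obtain ⟨v, hv, h⟩ := exists_ne_zero_forall_eval_eq_zero (η := ![l, m, f]) (by norm_num) (by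
      intro i
      fin_cases i <;> assumption)
    exact ⟨v, hv, h 0, h 1, h 2⟩
  obtain ⟨u, hu, hul, hum, hu2⟩ := hex _ (hξ 2)
  have hu0 : eval u (ξ 0) = 0 := by
    have := hQ u hul hum
    rw [hu2, mul_zero] at this
    exact eq_zero_of_pow_eq_zero this.symm
  by_cases hu1 : eval u (ξ 1) = 0
  · refine hpt u hu hul hum fun i => ?_
    fin_cases i <;> assumption
  · obtain ⟨v, hv, hvl, hvm, hv1⟩ := hex _ (hξ 1)
    have hv0 : eval v (ξ 0) = 0 := by
      have := hQ v hvl hvm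
      rw [hv1, zero_mul] at this
      exact eq_zero_of_pow_eq_zero this.symm
    have hv2 : eval v (ξ 2) = 0 := by
      have := hQ (u + v) (by rw [eval_add_of_isHomogeneous_one hl, hul, hvl, add_zero])
        (by rw [eval_add_of_isHomogeneous_one hm, hum, hvm, add_zero])
      simp only [eval_add_of_isHomogeneous_one (hξ _), hu0, hu2, hv0, hv1] at this
      simpa [hu1] using this
    refine hpt v hv hvl hvm fun i => ?_
    fin_cases i <;> assumption

/-- Three independent linear forms have only one common zero in `ℙ³`, so a form vanishing at both
points depends on `l` and `m`. -/
theorem span_pair_le_of_eval_eq_zero {p p' : Fin 4 → k} (hp0 : p ≠ 0) (hpp' : ∀ c : k, p' ≠ c • p)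
    {l m l' m' : CoordRing k} (hl : l.IsHomogeneous 1) (hm : m.IsHomogeneous 1)
    (hlm : LinearIndependent k ![l, m]) (hl' : l'.IsHomogeneous 1) (hm' : m'.IsHomogeneous 1)
    (hp : eval p l = 0 ∧ eval p m = 0) (hp' : eval p' l = 0 ∧ eval p' m = 0)
    (hq : eval p l' = 0 ∧ eval p m' = 0) (hq' : eval p' l' = 0 ∧ eval p' m' = 0) :
    Ideal.span {l', m'} ≤ Ideal.span {l, m} := by
  have key : ∀ h : CoordRing k, h.IsHomogeneous 1 → eval p h = 0 → eval p' h = 0 →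
      h ∈ Ideal.span {l, m} := by
    intro h hh h1 h2
    have hdep : ¬ LinearIndependent k (Fin.cons h ![l, m] : Fin 3 → CoordRing k) := by
      intro hind
      obtain ⟨c, hc⟩ := exists_eq_smul_of_eval_eq_zero (p := p) (u := p') (by
        intro i
        fin_cases i <;> assumption) hind hp0 (by
        intro i
        fin_cases i
        exacts [h1, hp.1, hp.2]) (by
        intro i
        fin_cases i
        exacts [h2, hp'.1, hp'.2])
      exact hpp' c hc
    rw [linearIndependent_finCons, not_and, not_not] at hdep
    have := hdep hlm
    rw [Matrix.range_cons, Matrix.range_cons, Matrix.range_empty, Set.union_empty,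
      Set.singleton_union] at this
    exact Submodule.span_le_restrictScalars k (CoordRing k) _ this
  rw [Ideal.span_le]
  rintro _ (rfl | rfl)
  exacts [key _ hl' hq.1 hq'.1, key _ hm' hq.2 hq'.2]

theorem IsSmoothConic.exists_linear_mem [IsAlgClosed k] (h2 : (2 : k) ≠ 0) {C : ClosedSubscheme k}
    (hC : C.IsSmoothConic) : ∃ l : CoordRing k, l.IsHomogeneous 1 ∧ l ≠ 0 ∧ l ∈ C.ideal := by
  obtain ⟨l, q, hl, hq, hCut, hjac⟩ := hC
  refine ⟨l, hl, ?_, ?_⟩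
  · rintro rfl
    -- If `l` were 0, the Jacobian criterion would fail at any zero of `q`; one is found in the
    -- plane `X₃ = 0`.
    let φ : CoordRing k →ₐ[k] MvPolynomial (Fin 3) k := aeval ![X 0, X 1, X 2, 0]
    have hφ : (φ q).IsHomogeneous 2 := by
      have := hq.aeval (![X 0, X 1, X 2, 0] : Fin 4 → MvPolynomial (Fin 3) k) (n := 1) (by
        intro i
        fin_cases i
        exacts [isHomogeneous_X _ _, isHomogeneous_X _ _, isHomogeneous_X _ _,
          isHomogeneous_zero _ _ _])
      simpa only [one_mul] using this
    obtain ⟨v, hv, hvq⟩ := exists_ne_zero_eval_eq_zero h2 hφ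
    have hev : eval v (φ q) = eval ![v 0, v 1, v 2, 0] q := by
      have : (aeval v : MvPolynomial (Fin 3) k →ₐ[k] k).comp φ =
          aeval ![v 0, v 1, v 2, 0] := by
        ext1 i
        fin_cases i <;> simp [φ, aeval_eq_eval]
      simpa [aeval_eq_eval] using DFunLike.congr_fun this q
    have := hjac ![v 0, v 1, v 2, 0] (by
      intro h
      apply hv
      ext i
      fin_cases i
      exacts [congrFun h 0, congrFun h 1, congrFun h 2]) (map_zero _) (hev ▸ hvq)
    refine this.ne_zero 0 ?_
    ext i
    simp
  · rw [hCut]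
    exact le_saturation _ (Ideal.subset_span (by simp))

theorem inter_comm (Y Z : ClosedSubscheme k) : Y.inter Z = Z.inter Y := by
  ext1
  change saturation _ = saturation _
  rw [sup_comm]

/-- The intersection of two conic cones with distinct vertices is one of the listed curves, and
spans `ℙ³`. -/
theorem IsConicCone.inter [IsAlgClosed k] (h2 : (2 : k) ≠ 0) {X₁ X₂ : ClosedSubscheme k}
    {p₁ p₂ : ℙ k (Fin 4 → k)} (hX₁ : X₁.IsConicCone p₁) (hX₂ : X₂.IsConicCone p₂)
    (hp : ∀ c : k, p₂.rep ≠ c • p₁.rep) (hp' : ∀ c : k, p₁.rep ≠ c • p₂.rep) :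
    (X₁.inter X₂).IsConeIntersection ∧ (X₁.inter X₂).IsNondegenerate := by
  obtain ⟨ξ, hξ, hli, hv, hcut⟩ := hX₁.exists_normalForm h2
  obtain ⟨ξ', hξ', hli', hv', hcut'⟩ := hX₂.exists_normalForm h2
  by_cases h1 : eval p₁.rep (ξ' 1 * ξ' 2 - ξ' 0 ^ 2) = 0
  swap
  · exact isConeIntersection_of_eval_ne_zero h2 hξ hli hv hξ' hli' p₂.rep_nonzero hv'
      (isCutOutBy_inter hcut hcut') h1
  by_cases h1' : eval p₂.rep (ξ 1 * ξ 2 - ξ 0 ^ 2) = 0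
  swap
  · rw [inter_comm]
    exact isConeIntersection_of_eval_ne_zero h2 hξ' hli' hv' hξ hli p₁.rep_nonzero hv
      (isCutOutBy_inter hcut' hcut) h1'
  have hvan : ∀ f ∈ X₁.ideal, eval p₂.rep f = 0 := by
    intro f hf
    rw [hcut] at hf
    exact eval_eq_zero_of_mem_saturation_span p₂.rep_nonzero (by rintro _ rfl; exact h1') hf
  have hvan' : ∀ f ∈ X₂.ideal, eval p₁.rep f = 0 := by
    intro f hf
    rw [hcut'] at hf
    exact eval_eq_zero_of_mem_saturation_span p₁.rep_nonzero (by rintro _ rfl; exact h1) hf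
  -- Both vertices now lie on both cones, so the coordinates are chosen anew, adapted to the common
  -- ruling.
  clear! ξ ξ'
  obtain ⟨ξ, hξ, hli, hv, hcut, h0, h3⟩ := hX₁.exists_normalForm_of_eval h2 hvan hp
  obtain ⟨ξ', hξ', hli', hv', hcut', h0', h3'⟩ := hX₂.exists_normalForm_of_eval h2 hvan' hp'
  refine isConeIntersection_of_common_line h2 hξ hli hv hξ' hli' hv' h0 h3 ?_ h0' h3' ?_
    (isCutOutBy_inter hcut hcut')
  · intro h
    obtain ⟨c, hc⟩ := exists_eq_smul_of_eval_eq_zero hξ hli p₁.rep_nonzero hv (u := p₂.rep) (by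
      intro i
      fin_cases i <;> assumption)
    exact hp c hc
  · intro h
    obtain ⟨c, hc⟩ := exists_eq_smul_of_eval_eq_zero hξ' hli' p₂.rep_nonzero hv' (u := p₁.rep) (by
      intro i
      fin_cases i <;> assumption)
    exact hp' c hc

theorem IsConicCone.eval_eq_zero_of_contains [IsAlgClosed k] (h2 : (2 : k) ≠ 0)
    {Z L : ClosedSubscheme k} {p : ℙ k (Fin 4 → k)} (hZ : Z.IsConicCone p) (hZL : Z.Contains L)
    {l m : CoordRing k} (hl : l.IsHomogeneous 1) (hm : m.IsHomogeneous 1)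
    (hL : L.IsCutOutBy {l, m}) : eval p.rep l = 0 ∧ eval p.rep m = 0 := by
  obtain ⟨ξ, hξ, hli, hv, hcut⟩ := hZ.exists_normalForm h2
  refine eval_eq_zero_of_isConicCone_contains p.rep_nonzero hξ hli hv ?_ hZL hl hm hL
  rw [hcut]
  exact le_saturation _ (Ideal.subset_span rfl)

theorem inter_contains {Y Z L : ClosedSubscheme k} (h : (Y.inter Z).Contains L) :
    Y.Contains L ∧ Z.Contains L :=
  ⟨le_trans (le_trans le_sup_left (le_saturation _)) h,
    le_trans (le_trans le_sup_right (le_saturation _)) h⟩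

end ClosedSubscheme

theorem rep_ne_smul_rep {p₁ p₂ : ℙ k (Fin 4 → k)} (hp : p₁ ≠ p₂) (c : k) :
    p₂.rep ≠ c • p₁.rep := by
  intro h
  apply hp
  rw [← p₁.mk_rep, ← p₂.mk_rep, eq_comm,
    Projectivization.mk_eq_mk_iff' k _ _ p₂.rep_nonzero p₁.rep_nonzero]
  exact ⟨c, h.symm⟩

end TwoCones

end ConicCones
-- The classification and the exclusions
open ConicCones in
theorem proposition4 {k : Type*} [Field k] [IsAlgClosed k] (h2 : (2 : k) ≠ 0)
    (X₁ X₂ : ClosedSubscheme k) (p₁ p₂ : ℙ k (Fin 4 → k))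
    (hX₁ : X₁.IsConicCone p₁) (hX₂ : X₂.IsConicCone p₂) (hp : p₁ ≠ p₂) :
    ((X₁.inter X₂).IsIrreducibleCurveOfDegree 4 ∨
      (∃ C L : ClosedSubscheme k, C.IsTwistedCubic ∧ L.IsLine ∧ X₁.inter X₂ = C.union L) ∨
      (∃ C D : ClosedSubscheme k, C.IsSmoothConic ∧ D.IsSmoothConic ∧ C ≠ D ∧
        X₁.inter X₂ = C.union D) ∨
      (∃ C D : ClosedSubscheme k, C.IsSmoothConic ∧ D.IsDoubledLine ∧
        X₁.inter X₂ = C.union D)) ∧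
    (¬ ∃ C : ClosedSubscheme k, C.IsSmoothConic ∧ (X₁.inter X₂).IsMultipleStructureOn 2 C) ∧
    (¬ ∃ L : ClosedSubscheme k, L.IsLine ∧ (X₁.inter X₂).IsMultipleStructureOn 4 L) ∧
    (¬ ∃ L M : ClosedSubscheme k, L.IsLine ∧ M.IsLine ∧ L ≠ M ∧
      (X₁.inter X₂).Contains L ∧ (X₁.inter X₂).Contains M) := by
  obtain ⟨hclass, hnd⟩ := hX₁.inter h2 hX₂ (rep_ne_smul_rep hp) (rep_ne_smul_rep hp.symm)
  refine ⟨hclass, ?_, ?_, ?_⟩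
  · rintro ⟨C, hC, hrad, -⟩
    obtain ⟨l, hl, hl0, hlC⟩ := hC.exists_linear_mem h2
    exact hl0 (hnd l hl (hrad ▸ hlC))
  · rintro ⟨L, ⟨l, m, hl, -, hlm, hL⟩, hrad, -⟩
    refine hlm.ne_zero 0 (hnd l hl ?_)
    rw [hrad, hL]
    exact le_saturation _ (Ideal.subset_span (by simp))
  · rintro ⟨L, M, ⟨l, m, hl, hm, hlm, hL⟩, ⟨l', m', hl', hm', hlm', hM⟩, hne, hZL, hZM⟩
    obtain ⟨hL₁, hL₂⟩ := ClosedSubscheme.inter_contains hZL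
    obtain ⟨hM₁, hM₂⟩ := ClosedSubscheme.inter_contains hZM
    have a₁ := hX₁.eval_eq_zero_of_contains h2 hL₁ hl hm hL
    have a₂ := hX₂.eval_eq_zero_of_contains h2 hL₂ hl hm hL
    have b₁ := hX₁.eval_eq_zero_of_contains h2 hM₁ hl' hm' hM
    have b₂ := hX₂.eval_eq_zero_of_contains h2 hM₂ hl' hm' hM
    have hp' := rep_ne_smul_rep hp
    apply hne
    ext1
    rw [hL, hM]
    congr 1
    -- All four linear forms vanish at both vertices, so each pair generates the ideal of the line
    -- joining them.
    exact le_antisymm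
      (ClosedSubscheme.span_pair_le_of_eval_eq_zero p₁.rep_nonzero hp' hl' hm' hlm' hl hm
        b₁ b₂ a₁ a₂)
      (ClosedSubscheme.span_pair_le_of_eval_eq_zero p₁.rep_nonzero hp' hl hm hlm hl' hm'
        a₁ a₂ b₁ b₂)
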